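/- Let $\mathbb D$ be the open unit disk of $\mathbb C$ and let $\beta=(\beta_n)_{n\ge 0}$ be a sequence of positive numbers that is essentially decreasing (there is $C\ge 1$ with $\beta_m\le C\,\beta_n$ for all $m\ge n\ge 0$) and satisfies the $\Delta_2$-condition (there is $\delta\in(0,1)$ with $\beta_{2n}\ge\delta\,\beta_n$ for all $n\ge 0$). Let $H^2(\beta)$ be the space of the analytic functions $f(z)=\sum_{n\ge 0}a_nz^n$ on $\mathbb D$ with $\|f\|^2=\sum_{n\ge 0}|a_n|^2\beta_n<\infty$, with the corresponding inner product; $H^2$ is the case $\beta_n\equiv 1$. Then $H^2(\beta)$ is an admissible Hilbert space of analytic functions on $\mathbb D$. That is, $H=H^2(\beta)$ is a Hilbert space, contains the constants, has reproducing kernels $K_a$, $a\in\mathbb D$, and: (i) $H^2$ is continuously embedded in $H$: $H^2\subseteq H$ and the inclusion is bounded; (ii) $\mathcal M(H)=H^\infty$, where $\mathcal M(H)$ is the set of the analytic functions $w$ on $\mathbb D$ such that $wf\in H$ for all $f\in H$, and $H^\infty$ is the set of the bounded analytic functions on $\mathbb D$; (iii) for every analytic automorphism $\varphi$ of $\mathbb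 D$, $f\mapsto f\circ\varphi$ is a bounded operator from $H$ to $H$; (iv) there is a non-decreasing function $h\colon(0,\infty)\to[0,\infty)$ such that, for all $a,b\in\mathbb D$, $$\frac{\|K_a\|_H}{\|K_b\|_H}\le h\!\left(\frac{1-|b|}{1-|a|}\right).$$ -/

import Mathlib

open scoped ComplexConjugate Complex.UnitDisc

noncomputable section

namespace HardyWeighted

/-- Extension by `0` to the whole plane of a function on the open unit disk. -/
def extend (f : 𝔻 → ℂ) (z : ℂ) : ℂ := if hz : ‖z‖ < 1 then f (Complex.UnitDisc.mk z hz) else 0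

/-- `f` is analytic (holomorphic) on the open unit disk. -/
def IsHolo (f : 𝔻 → ℂ) : Prop := DifferentiableOn ℂ (extend f) (Metric.ball 0 1)

/-- The `n`-th Taylor coefficient at `0` of a function on the open unit disk. -/
def coeff (f : 𝔻 → ℂ) (n : ℕ) : ℂ := iteratedDeriv n (extend f) 0 / (n.factorial : ℂ)

theorem extend_coe (f : 𝔻 → ℂ) (z : 𝔻) : extend f z = f z := by
  simp [extend, z.norm_lt_one]

theorem extend_zero : extend 0 = 0 := by
  funext z; simp [extend]

theorem extend_add (f g : 𝔻 → ℂ) : extend (f + g) = extend f + extend g := by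
  funext z; by_cases hz : ‖z‖ < 1 <;> simp [extend, hz]

theorem extend_smul (c : ℂ) (f : 𝔻 → ℂ) : extend (c • f) = c • extend f := by
  funext z; by_cases hz : ‖z‖ < 1 <;> simp [extend, hz]

theorem IsHolo.zero : IsHolo 0 := by
  rw [IsHolo, extend_zero]; exact differentiableOn_const 0

theorem IsHolo.add {f g : 𝔻 → ℂ} (hf : IsHolo f) (hg : IsHolo g) : IsHolo (f + g) := by
  rw [IsHolo, extend_add]; exact DifferentiableOn.add hf hg

theorem IsHolo.smul (c : ℂ) {f : 𝔻 → ℂ} (hf : IsHolo f) : IsHolo (c • f) := by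
  rw [IsHolo, extend_smul]; exact DifferentiableOn.const_smul hf c

theorem IsHolo.contDiffAt {f : 𝔻 → ℂ} (hf : IsHolo f) (n : ℕ) :
    ContDiffAt ℂ n (extend f) 0 :=
  (DifferentiableOn.analyticAt hf (Metric.ball_mem_nhds 0 one_pos)).contDiffAt

theorem coeff_zero (n : ℕ) : coeff 0 n = 0 := by
  have h : extend (0 : 𝔻 → ℂ) = fun _ => 0 := extend_zero
  simp [coeff, h]

theorem coeff_add {f g : 𝔻 → ℂ} (hf : IsHolo f) (hg : IsHolo g) (n : ℕ) :
    coeff (f + g) n = coeff f n + coeff g n := by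
  rw [coeff, extend_add, iteratedDeriv_add (hf.contDiffAt n) (hg.contDiffAt n), add_div]; rfl

theorem coeff_smul (c : ℂ) {f : 𝔻 → ℂ} (hf : IsHolo f) (n : ℕ) :
    coeff (c • f) n = c * coeff f n := by
  rw [coeff, extend_smul, iteratedDeriv_const_smul (hf.contDiffAt n), smul_eq_mul,
    mul_div_assoc]; rfl

/-- An analytic function on the disk is the sum of its Taylor series at `0`. -/
theorem hasSum_coeff {f : 𝔻 → ℂ} (hf : IsHolo f) (z : 𝔻) :
    HasSum (fun n => coeff f n * (z : ℂ) ^ n) (f z) := by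
  have h := Complex.hasSum_taylorSeries_on_ball (f := extend f) (c := 0) (r := 1) hf
    (z := (z : ℂ)) (by simpa using z.norm_lt_one)
  rw [extend_coe] at h
  have e : (fun n => coeff f n * (z : ℂ) ^ n) = fun n : ℕ =>
      (n.factorial : ℂ)⁻¹ • ((z : ℂ) - 0) ^ n • iteratedDeriv n (extend f) 0 := by
    funext n
    simp only [coeff, div_eq_inv_mul, sub_zero, smul_eq_mul]
    ring
  rw [e]
  exact h

/-- A sequence of positive numbers is essentially decreasing. -/
def EssentiallyDecreasing (β : ℕ → {x : ℝ // 0 < x}) : Prop :=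
  ∃ C : ℝ, 1 ≤ C ∧ ∀ n m : ℕ, n ≤ m → (β m : ℝ) ≤ C * β n

/-- The `Δ₂`-condition. -/
def DeltaTwo (β : ℕ → {x : ℝ // 0 < x}) : Prop :=
  ∃ δ : ℝ, 0 < δ ∧ δ < 1 ∧ ∀ n : ℕ, δ * β n ≤ (β (2 * n) : ℝ)

theorem summable_inner (β : ℕ → {x : ℝ // 0 < x}) {a b : ℕ → ℂ}
    (ha : Summable fun n => ‖a n‖ ^ 2 * (β n : ℝ))
    (hb : Summable fun n => ‖b n‖ ^ 2 * (β n : ℝ)) :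
    Summable fun n => conj (a n) * b n * ((β n : ℝ) : ℂ) := by
  refine Summable.of_norm_bounded (ha.add hb) fun n => ?_
  have hβ := (β n).2
  rw [norm_mul, norm_mul, RCLike.norm_conj, Complex.norm_real, Real.norm_of_nonneg hβ.le]
  nlinarith [mul_nonneg (sq_nonneg (‖a n‖ - ‖b n‖)) hβ.le,
    mul_nonneg (mul_nonneg (norm_nonneg (a n)) (norm_nonneg (b n))) hβ.le]

/-- The vector space of the analytic functions `f = ∑ aₙ zⁿ` on the disk such that
`∑ |aₙ|² βₙ < ∞`. -/
def weightedHardySubmodule (β : ℕ → {x : ℝ // 0 < x}) : Submodule ℂ (𝔻 → ℂ) where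
  carrier := {f | IsHolo f ∧ Summable fun n => ‖coeff f n‖ ^ 2 * (β n : ℝ)}
  zero_mem' := ⟨IsHolo.zero, by simp [coeff_zero]⟩
  add_mem' := by
    rintro f g ⟨hf, hf'⟩ ⟨hg, hg'⟩
    refine ⟨hf.add hg, Summable.of_nonneg_of_le
      (fun n => mul_nonneg (sq_nonneg _) (β n).2.le) (fun n => ?_)
      ((hf'.mul_left 2).add (hg'.mul_left 2))⟩
    rw [coeff_add hf hg]
    have h1 : ‖coeff f n + coeff g n‖ ^ 2 ≤ 2 * ‖coeff f n‖ ^ 2 + 2 * ‖coeff g n‖ ^ 2 := by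
      have := norm_add_le (coeff f n) (coeff g n)
      nlinarith [norm_nonneg (coeff f n + coeff g n), sq_nonneg (‖coeff f n‖ - ‖coeff g n‖)]
    nlinarith [mul_le_mul_of_nonneg_right h1 (β n).2.le]
  smul_mem' := by
    rintro c f ⟨hf, hf'⟩
    refine ⟨hf.smul c, ?_⟩
    simp_rw [coeff_smul c hf, norm_mul, mul_pow, mul_assoc]
    exact hf'.mul_left _

/-- The weighted Hardy space `H²(β)`. This is a type of its own, so that its topology is that of
the norm below, and not that of pointwise convergence. -/
def WeightedHardy (β : ℕ → {x : ℝ // 0 < x}) : Type := weightedHardySubmodule β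

namespace WeightedHardy

variable (β : ℕ → {x : ℝ // 0 < x})

instance : AddCommGroup (WeightedHardy β) := inferInstanceAs (AddCommGroup (weightedHardySubmodule β))

instance : Module ℂ (WeightedHardy β) := inferInstanceAs (Module ℂ (weightedHardySubmodule β))

/-- The elements of `H²(β)` as functions on the disk. -/
def toFun : WeightedHardy β →ₗ[ℂ] (𝔻 → ℂ) := (weightedHardySubmodule β).subtype

theorem isHolo (f : WeightedHardy β) : IsHolo (toFun β f) := f.2.1

theorem summable (f : WeightedHardy β) :
    Summable fun n => ‖coeff (toFun β f) n‖ ^ 2 * (β n : ℝ) := f.2.2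

theorem inner_self_aux (f : WeightedHardy β) :
    ∑' n, conj (coeff (toFun β f) n) * coeff (toFun β f) n * ((β n : ℝ) : ℂ)
      = ((∑' n, ‖coeff (toFun β f) n‖ ^ 2 * (β n : ℝ) : ℝ) : ℂ) := by
  rw [Complex.ofReal_tsum]
  refine tsum_congr fun n => ?_
  rw [Complex.conj_mul']
  push_cast
  rfl

/-- The inner product `⟪f, g⟫ = ∑ conj aₙ bₙ βₙ` (conjugate-linear in the first variable),
where `f = ∑ aₙ zⁿ` and `g = ∑ bₙ zⁿ`. -/
abbrev core : InnerProductSpace.Core ℂ (WeightedHardy β) where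
  inner f g := ∑' n, conj (coeff (toFun β f) n) * coeff (toFun β g) n * ((β n : ℝ) : ℂ)
  conj_inner_symm f g := by
    rw [Complex.conj_tsum]
    refine tsum_congr fun n => ?_
    simp only [map_mul, Complex.conj_conj, Complex.conj_ofReal]
    ring
  re_inner_nonneg f := by
    rw [inner_self_aux]
    exact tsum_nonneg fun n => mul_nonneg (sq_nonneg _) (β n).2.le
  add_left f g h := by
    rw [← (summable_inner β (summable β f) (summable β h)).tsum_add
      (summable_inner β (summable β g) (summable β h))]
    refine tsum_congr fun n => ?_
    rw [map_add, coeff_add (isHolo β f) (isHolo β g), map_add]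
    ring
  smul_left f g c := by
    rw [← tsum_mul_left]
    refine tsum_congr fun n => ?_
    rw [map_smul, coeff_smul c (isHolo β f), map_mul]
    ring
  definite f h := by
    rw [inner_self_aux, Complex.ofReal_eq_zero] at h
    have h1 := (summable β f).hasSum
    rw [h, hasSum_zero_iff_of_nonneg fun n => mul_nonneg (sq_nonneg _) (β n).2.le] at h1
    have h0 : ∀ n, coeff (toFun β f) n = 0 := fun n => by
      simpa [(β n).2.ne'] using congrFun h1 n
    refine Subtype.ext (funext fun z => ?_)
    have hs := hasSum_coeff (isHolo β f) z
    simp only [h0, zero_mul] at hs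
    exact hs.unique hasSum_zero

instance : NormedAddCommGroup (WeightedHardy β) := (core β).toNormedAddCommGroup

instance : InnerProductSpace ℂ (WeightedHardy β) := InnerProductSpace.ofCore (core β).toCore

/-- `‖f‖² = ∑ |aₙ|² βₙ`. -/
theorem norm_sq_eq (f : WeightedHardy β) :
    ‖f‖ ^ 2 = ∑' n, ‖coeff (toFun β f) n‖ ^ 2 * (β n : ℝ) := by
  have h : inner ℂ f f = ((∑' n, ‖coeff (toFun β f) n‖ ^ 2 * (β n : ℝ) : ℝ) : ℂ) :=
    inner_self_aux β f
  rw [← Complex.ofReal_inj, ← h, inner_self_eq_norm_sq_to_K]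
  push_cast
  rfl

end WeightedHardy

/-- The usual Hardy space `H²`, that is, the space `H²(β)` for `β` constantly equal to `1`. -/
abbrev HardyTwo : Type := WeightedHardy fun _ => ⟨1, one_pos⟩

/-- `H^∞`: the bounded analytic functions on the disk. -/
def HInfty : Set (𝔻 → ℂ) := {w | IsHolo w ∧ ∃ M : ℝ, ∀ z, ‖w z‖ ≤ M}

/-- The multipliers of a space `H` of functions on the disk (`ev f` is the function given by the
element `f` of `H`): the analytic functions `w` such that `w f ∈ H` for all `f ∈ H`. -/
def multipliers {H : Type*} (ev : H → 𝔻 → ℂ) : Set (𝔻 → ℂ) :=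
  {w | IsHolo w ∧ ∀ f : H, ∃ g : H, ev g = w * ev f}

/-- `φ` is an analytic automorphism of the open unit disk. -/
def IsDiskAutomorphism (φ : 𝔻 ≃ 𝔻) : Prop :=
  IsHolo (fun z => (φ z : ℂ)) ∧ IsHolo (fun z => (φ.symm z : ℂ))

/-- `H`, whose elements `f` are viewed as the functions `ev f`, is an admissible Hilbert space of
analytic functions on the open unit disk. -/
structure IsAdmissible {H : Type*} [NormedAddCommGroup H] [InnerProductSpace ℂ H]
    (ev : H →ₗ[ℂ] (𝔻 → ℂ)) : Prop where
  /-- `H` is a Hilbert space -/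
  complete : CompleteSpace H
  /-- the elements of `H` are functions on the disk -/
  injective : Function.Injective ev
  /-- which are analytic -/
  isHolo : ∀ f : H, IsHolo (ev f)
  /-- `H` contains the constants -/
  constants : ∀ c : ℂ, ∃ f : H, ev f = fun _ => c
  /-- `H²` is continuously embedded in `H` -/
  hardy_embedding : ∃ J : HardyTwo →L[ℂ] H, ∀ f, ev (J f) = WeightedHardy.toFun _ f
  /-- the multipliers of `H` are the functions of `H^∞` -/
  multipliers_eq : multipliers ev = HInfty
  /-- the automorphisms of the disk induce bounded composition operators on `H` -/
  automorphism_bounded : ∀ φ : 𝔻 ≃ 𝔻, IsDiskAutomorphism φ →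
    ∃ T : H →L[ℂ] H, ∀ f, ev (T f) = ev f ∘ φ
  /-- `H` has reproducing kernels `K a`, with the following control of their norms -/
  kernel_bound : ∃ K : 𝔻 → H, (∀ (a : 𝔻) (f : H), inner ℂ (K a) f = ev f a) ∧
    ∃ h : ℝ → ℝ, (∀ x, 0 < x → 0 ≤ h x) ∧ MonotoneOn h (Set.Ioi 0) ∧
      ∀ a b : 𝔻, ‖K a‖ / ‖K b‖ ≤ h ((1 - ‖(b : ℂ)‖) / (1 - ‖(a : ℂ)‖))

end HardyWeighted

end

/-!
The spaces `H²(β)` are compared with means over circles. By Parseval's formula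
`∑ |aₙ|² ρ ^ (2 n)` is the mean of `|f|²` over the circle of radius `ρ`, and a decreasing weight `b`
with `b ⌊n / 2⌋ ≤ E b n` is comparable with a mixture of weights `R ^ (2 n)`: summation by parts
writes `b` as a mixture of indicator functions of initial segments `n ≤ N`, the one of `n ≤ N` is at
most `2 ρ ^ (2 n)` with `1 - ρ ≍ 1 / N`, and the doubling property permits the return from
`R ^ (2 n)` with `1 - R = c (1 - ρ)` to `b`. This is `exists_weighted_sum_le`. Hence an operation
`f ↦ g` on analytic functions is bounded on `H²(β)` as soon as the mean of `|g|²` over the circle of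
radius `ρ` is at most a constant times the mean of `|f|²` over the circle of radius `1 - c (1 - ρ)`
(`exists_weighted_bound`).

For `g = w f` with `w` bounded this is obvious, with `c = 1`. For `g = f ∘ φ` it is Littlewood's
subordination principle (`circleAverage_comp_le`): `|f|²` is dominated by the real part of its
Herglotz integral `H` over the larger circle, and the mean of `re (H ∘ φ)` is its value at `0`; the
Schwarz–Pick lemma gives the relation between the two radii (`le_one_sub_norm_of_mapsTo`). No
property of `φ` other than being an analytic self-map of the disk is used.

The doubling property also makes `1 / β n` grow at most polynomially, so that all the sequences `a`
with `∑ |aₙ|² βₙ < ∞` are coefficient sequences (whence completeness) and the reproducing kernels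
exist, with `‖K_a‖² = κ(|a|²)`, `κ(r) = ∑ rⁿ / βₙ`. Splitting the sum into even and odd indices gives
`κ(r) ≤ 2 E κ(r²)` (`tsum_pow_div_le`), and iteration of this gives the estimate of the quotients
`‖K_a‖ / ‖K_b‖`. That multipliers are bounded follows from the closed graph theorem and the
identity `w a ‖K_a‖² = ⟪K_a, w K_a⟫`.
-/

namespace HardyWeighted

/-! ### Doubling weights -/

/-- The doubling property of weights in the form in which it is used: `b n` and `b ⌊n / 2⌋` are
comparable, the odd indices included. -/
def HalfBound (b : ℕ → ℝ) (E : ℝ) : Prop := ∀ n, b (n / 2) ≤ E * b n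

theorem exists_halfBound {β : ℕ → {x : ℝ // 0 < x}} (hβ : EssentiallyDecreasing β)
    (hΔ : DeltaTwo β) : ∃ E : ℝ, 1 ≤ E ∧ HalfBound (fun n => (β n : ℝ)) E := by
  obtain ⟨C, hC, hβ⟩ := hβ
  obtain ⟨δ, hδ, hδ1, hΔ⟩ := hΔ
  have pos : ∀ n, 0 < (β n : ℝ) := fun n => (β n).2
  have hinv : ∀ n, (β n : ℝ) ≤ δ⁻¹ * β (2 * n) := fun n => by
    rw [inv_mul_eq_div, le_div_iff₀ hδ, mul_comm]
    exact hΔ n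
  have hδi : 1 ≤ δ⁻¹ := (one_le_inv₀ hδ).2 hδ1.le
  refine ⟨max (δ⁻¹ * δ⁻¹ * C) ((β 0 : ℝ) / β 1), ?_, fun n => ?_⟩
  · exact le_max_of_le_left (one_le_mul_of_one_le_of_one_le
      (one_le_mul_of_one_le_of_one_le hδi hδi) hC)
  have key : ∀ n, 2 ≤ n ∨ n = 0 → (β (n / 2) : ℝ) ≤ δ⁻¹ * δ⁻¹ * C * β n := fun n hn => by
    -- two doublings lead from `⌊n / 2⌋` to an index that is at least `n`
    have h1 := hinv (n / 2)
    have h2 := hinv (2 * (n / 2))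
    have h3 := hβ n (2 * (2 * (n / 2))) (by omega)
    have h0 : 0 ≤ δ⁻¹ := by positivity
    calc (β (n / 2) : ℝ) ≤ δ⁻¹ * (δ⁻¹ * (C * β n)) :=
          h1.trans (mul_le_mul_of_nonneg_left (h2.trans (mul_le_mul_of_nonneg_left h3 h0)) h0)
      _ = _ := by ring
  by_cases hn : n = 1
  · subst hn
    calc (β (1 / 2) : ℝ) = (β 0 : ℝ) / β 1 * β 1 := by
          rw [div_mul_cancel₀ _ (pos 1).ne']
      _ ≤ _ := mul_le_mul_of_nonneg_right (le_max_right _ _) (pos 1).le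
  · exact (key n (by omega)).trans (mul_le_mul_of_nonneg_right (le_max_left _ _) (pos n).le)

/-- An essentially decreasing doubling weight is equivalent to a decreasing doubling weight,
namely to `sup_{m ≥ n} β m`. -/
theorem exists_antitone_envelope {β : ℕ → {x : ℝ // 0 < x}} (hβ : EssentiallyDecreasing β)
    (hΔ : DeltaTwo β) : ∃ (b : ℕ → ℝ) (C E : ℝ), 0 < C ∧ 1 ≤ E ∧ Antitone b ∧ HalfBound b E ∧
      ∀ n, (β n : ℝ) ≤ b n ∧ b n ≤ C * β n := by
  obtain ⟨E, hE, hhalf⟩ := exists_halfBound hβ hΔ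
  obtain ⟨C, hC, hβ⟩ := hβ
  have hbdd : ∀ n, BddAbove (Set.range fun m => (β (n + m) : ℝ)) := fun n =>
    ⟨C * β n, by rintro _ ⟨m, rfl⟩; exact hβ n _ (by omega)⟩
  have hle : ∀ n, (β n : ℝ) ≤ ⨆ m, (β (n + m) : ℝ) := fun n => le_ciSup (hbdd n) 0
  have hge : ∀ n, (⨆ m, (β (n + m) : ℝ)) ≤ C * β n := fun n =>
    ciSup_le fun m => hβ n _ (by omega)
  refine ⟨fun n => ⨆ m, (β (n + m) : ℝ), C, C * E, by linarith,
    one_le_mul_of_one_le_of_one_le hC hE, ?_, ?_, fun n => ⟨hle n, hge n⟩⟩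
  · refine antitone_nat_of_succ_le fun n => ciSup_le fun m => ?_
    have := le_ciSup (hbdd n) (m + 1)
    simpa [add_assoc, add_comm 1 m] using this
  · intro n
    refine (hge _).trans ?_
    rw [mul_assoc]
    exact mul_le_mul_of_nonneg_left ((hhalf n).trans
      (mul_le_mul_of_nonneg_left (hle n) (by linarith))) (by linarith)

theorem sum_Ico_sub_succ (b : ℕ → ℝ) {m n : ℕ} (hmn : m ≤ n) :
    ∑ N ∈ Finset.Ico m n, (b N - b (N + 1)) = b m - b n := by
  rw [← neg_sub (b n), ← Finset.sum_Ico_sub b hmn, ← Finset.sum_neg_distrib]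
  simp

/-- For a decreasing doubling weight the sums `∑_{N < n} (b N - b (N + 1)) (N + 1) ^ q` are dominated
by `n ^ q b n`, as soon as `q` beats the doubling constant: halving `n` gains the factor `2 ^ q` and
loses at most the factor `E`. -/
theorem sum_sub_mul_pow_le {b : ℕ → ℝ} (hb : Antitone b) (hpos : ∀ n, 0 < b n) {E : ℝ} (hE : 1 ≤ E)
    (hhalf : HalfBound b E) {q : ℕ} (hq : 2 * E ≤ 2 ^ q) (n : ℕ) :
    ∑ N ∈ Finset.range n, (b N - b (N + 1)) * ((N : ℝ) + 1) ^ q ≤ 2 * E * (n : ℝ) ^ q * b n := by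
  induction n using Nat.strong_induction_on with
  | _ n ih =>
    rcases Nat.eq_zero_or_pos n with rfl | hn
    · have := (hpos 0).le
      simpa using by positivity
    have hm : n / 2 < n := by omega
    have h1 := ih _ hm
    rw [← Finset.sum_range_add_sum_Ico _ hm.le]
    have h2 : ∑ N ∈ Finset.Ico (n / 2) n, (b N - b (N + 1)) * ((N : ℝ) + 1) ^ q
        ≤ (b (n / 2) - b n) * (n : ℝ) ^ q := by
      have h3 : ∑ N ∈ Finset.Ico (n / 2) n, (b N - b (N + 1)) = b (n / 2) - b n :=
        sum_Ico_sub_succ b hm.le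
      rw [← h3, Finset.sum_mul]
      refine Finset.sum_le_sum fun N hN => mul_le_mul_of_nonneg_left ?_
        (sub_nonneg.2 (hb (Nat.le_succ N)))
      have : (N : ℝ) + 1 ≤ n := by exact_mod_cast (Finset.mem_Ico.1 hN).2
      gcongr
    have h4 : ((n / 2 : ℕ) : ℝ) ^ q ≤ (n : ℝ) ^ q / 2 ^ q := by
      rw [← div_pow]
      exact pow_le_pow_left₀ (by positivity) Nat.cast_div_le q
    have hbn := (hpos n).le
    have hbm := (hpos (n / 2)).le
    have hnq : 0 ≤ (n : ℝ) ^ q := by positivity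
    have h5 : 2 * E * ((n / 2 : ℕ) : ℝ) ^ q ≤ (n : ℝ) ^ q := by
      calc 2 * E * ((n / 2 : ℕ) : ℝ) ^ q ≤ 2 ^ q * ((n : ℝ) ^ q / 2 ^ q) := by gcongr
        _ = (n : ℝ) ^ q := by field_simp
    have h6 := mul_le_mul_of_nonneg_right h5 hbm
    have h7 := mul_le_mul_of_nonneg_left (hhalf n) hnq
    nlinarith [mul_nonneg hnq hbn]

/-- Summation by parts. -/
theorem sum_mul_eq_sum_sub_mul_sum (y b : ℕ → ℝ) (M : ℕ) :
    ∑ n ∈ Finset.range (M + 1), y n * b n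
      = ∑ N ∈ Finset.range M, (b N - b (N + 1)) * ∑ n ∈ Finset.range (N + 1), y n
        + b M * ∑ n ∈ Finset.range (M + 1), y n := by
  induction M with
  | zero => simp [mul_comm]
  | succ M ih =>
    rw [Finset.sum_range_succ, ih, Finset.sum_range_succ y (M + 1),
      Finset.sum_range_succ (fun N => (b N - b (N + 1)) * ∑ n ∈ Finset.range (N + 1), y n) M]
    ring

/-- The powers of the radius `1 - c / (4 (N + 1))` decay like any power of `(N + 1) / k`. -/
theorem radius_pow_le {c : ℝ} (hc : 0 < c) (hc1 : c ≤ 1) (q N : ℕ) {k : ℕ} (hk : 0 < k) :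
    (1 - c * (1 / (4 * ((N : ℝ) + 1)))) ^ (2 * k)
      ≤ (q.factorial : ℝ) * (4 / c) ^ q / (k : ℝ) ^ q * ((N : ℝ) + 1) ^ q := by
  set s : ℝ := c * (1 / (4 * ((N : ℝ) + 1))) with hs
  have hs0 : 0 < s := by positivity
  have hs1 : s ≤ 1 := by
    have h1 : 1 / (4 * ((N : ℝ) + 1)) ≤ 1 := by
      rw [div_le_one (by positivity)]
      linarith [(Nat.cast_nonneg N : (0 : ℝ) ≤ N)]
    exact mul_le_one₀ hc1 (by positivity) h1
  have hk' : (0 : ℝ) < k := by exact_mod_cast hk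
  have h1 : (1 - s) ^ (2 * k) ≤ (1 - s) ^ k :=
    pow_le_pow_of_le_one (by linarith) (by linarith) (by omega)
  have h2 : (1 - s) ^ k ≤ Real.exp (-(k * s)) := by
    calc (1 - s) ^ k ≤ Real.exp (-s) ^ k :=
          pow_le_pow_left₀ (by linarith) (Real.one_sub_le_exp_neg s) k
      _ = Real.exp (-(k * s)) := by rw [← Real.exp_nat_mul]; ring_nf
  have h3 := Real.pow_div_factorial_le_exp (x := k * s) (by positivity) q
  have hq : (0 : ℝ) < q.factorial := by exact_mod_cast q.factorial_pos
  calc (1 - s) ^ (2 * k) ≤ (Real.exp (k * s))⁻¹ := by rw [← Real.exp_neg]; exact h1.trans h2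
    _ ≤ ((k * s) ^ q / q.factorial)⁻¹ := inv_anti₀ (by positivity) h3
    _ = _ := by
      rw [hs, mul_pow, mul_pow, div_pow, div_pow, mul_pow, one_pow]
      field_simp

/-- A decreasing doubling weight is, up to constants, at least the mixture of the weights
`k ↦ R ^ (2 k)` that summation by parts produces. -/
theorem exists_mixture_le {b : ℕ → ℝ} (hb : Antitone b) (hpos : ∀ n, 0 < b n) {E : ℝ} (hE : 1 ≤ E)
    (hhalf : HalfBound b E) {c : ℝ} (hc : 0 < c) (hc1 : c ≤ 1) :
    ∃ G : ℝ, 0 ≤ G ∧ ∀ M k : ℕ,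
      ∑ N ∈ Finset.range M, (b N - b (N + 1)) * (1 - c * (1 / (4 * ((N : ℝ) + 1)))) ^ (2 * k)
        + b M * (1 - c * (1 / (4 * ((M : ℝ) + 1)))) ^ (2 * k) ≤ G * b k := by
  obtain ⟨q, hq⟩ := pow_unbounded_of_one_lt (2 * E) (one_lt_two (α := ℝ))
  set R : ℕ → ℝ := fun N => 1 - c * (1 / (4 * ((N : ℝ) + 1))) with hR
  have hs : ∀ N : ℕ, 0 ≤ c * (1 / (4 * ((N : ℝ) + 1))) := fun N => by positivity
  have hR1 : ∀ N, R N ≤ 1 := fun N => by simp only [hR]; linarith [hs N]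
  have hR0 : ∀ N, 0 ≤ R N := fun N => by
    have h1 : 1 / (4 * ((N : ℝ) + 1)) ≤ 1 := by
      rw [div_le_one (by positivity)]
      linarith [(Nat.cast_nonneg N : (0 : ℝ) ≤ N)]
    have := mul_le_one₀ hc1 (by positivity) h1
    simp only [hR]; linarith
  have hRmono : ∀ N, R N ≤ R (N + 1) := fun N => by
    simp only [hR]
    push_cast
    gcongr
    linarith
  have hΔ : ∀ N, 0 ≤ b N - b (N + 1) := fun N => sub_nonneg.2 (hb (Nat.le_succ N))
  set K : ℝ := (q.factorial : ℝ) * (4 / c) ^ q with hK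
  have hK0 : 0 ≤ K := by positivity
  refine ⟨K * (2 * E) + 1, by positivity, fun M k => ?_⟩
  set W : ℕ → ℝ := fun M => ∑ N ∈ Finset.range M, (b N - b (N + 1)) * R N ^ (2 * k)
    + b M * R M ^ (2 * k) with hW
  have hWmono : Monotone W := monotone_nat_of_le_succ fun M => by
    simp only [hW, Finset.sum_range_succ]
    have := mul_le_mul_of_nonneg_left
      (pow_le_pow_left₀ (hR0 M) (hRmono M) (2 * k)) (hpos (M + 1)).le
    linarith
  -- it suffices to treat large `M`
  refine (hWmono (le_max_left M k)).trans ?_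
  have hkM : k ≤ max M k := le_max_right M k
  generalize max M k = M at hkM
  have hfirst : ∑ N ∈ Finset.range k, (b N - b (N + 1)) * R N ^ (2 * k) ≤ K * (2 * E) * b k := by
    rcases Nat.eq_zero_or_pos k with rfl | hk
    · have := (hpos 0).le
      simpa using by positivity
    have hk' : (0 : ℝ) < k := by exact_mod_cast hk
    calc ∑ N ∈ Finset.range k, (b N - b (N + 1)) * R N ^ (2 * k)
        ≤ ∑ N ∈ Finset.range k, K / (k : ℝ) ^ q * ((b N - b (N + 1)) * ((N : ℝ) + 1) ^ q) := by
          refine Finset.sum_le_sum fun N _ => ?_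
          have := mul_le_mul_of_nonneg_left (radius_pow_le hc hc1 q N hk) (hΔ N)
          calc _ ≤ _ := this
            _ = _ := by simp only [hK]; ring
      _ = K / (k : ℝ) ^ q * ∑ N ∈ Finset.range k, (b N - b (N + 1)) * ((N : ℝ) + 1) ^ q := by
          rw [Finset.mul_sum]
      _ ≤ K / (k : ℝ) ^ q * (2 * E * (k : ℝ) ^ q * b k) :=
          mul_le_mul_of_nonneg_left (sum_sub_mul_pow_le hb hpos hE hhalf hq.le k) (by positivity)
      _ = K * (2 * E) * b k := by field_simp
  have hsecond : ∑ N ∈ Finset.Ico k M, (b N - b (N + 1)) * R N ^ (2 * k) + b M * R M ^ (2 * k)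
      ≤ b k := by
    have h3 : ∑ N ∈ Finset.Ico k M, (b N - b (N + 1)) = b k - b M := sum_Ico_sub_succ b hkM
    have h4 : ∑ N ∈ Finset.Ico k M, (b N - b (N + 1)) * R N ^ (2 * k)
        ≤ ∑ N ∈ Finset.Ico k M, (b N - b (N + 1)) := Finset.sum_le_sum fun N _ =>
      mul_le_of_le_one_right (hΔ N) (pow_le_one₀ (hR0 N) (hR1 N))
    have h5 := mul_le_of_le_one_right (hpos M).le (pow_le_one₀ (n := 2 * k) (hR0 M) (hR1 M))
    linarith
  simp only [hW]
  rw [← Finset.sum_range_add_sum_Ico _ hkM]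
  linarith

/-- If the square sums of `∑ dₙ zⁿ` over the circle of radius `ρ` are controlled by those of
`∑ aₙ zⁿ` over the circle of radius `1 - c (1 - ρ)`, for all `ρ`, then the weighted square sums of
`d` are controlled by those of `a`. Here `x n` and `y n` stand for `|aₙ|²` and `|dₙ|²`. -/
theorem exists_weighted_sum_le {b : ℕ → ℝ} (hb : Antitone b) (hpos : ∀ n, 0 < b n) {E : ℝ}
    (hE : 1 ≤ E) (hhalf : HalfBound b E) {c : ℝ} (hc : 0 < c) (hc1 : c ≤ 1) {A : ℝ} (hA : 0 ≤ A) :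
    ∃ B : ℝ, 0 ≤ B ∧ ∀ x y : ℕ → ℝ, (∀ n, 0 ≤ x n) → (∀ n, 0 ≤ y n) →
      (Summable fun n => x n * b n) →
      (∀ ρ : ℝ, 0 < ρ → ρ < 1 → Summable (fun n => x n * (1 - c * (1 - ρ)) ^ (2 * n)) ∧
        ∀ N, ∑ n ∈ Finset.range N, y n * ρ ^ (2 * n)
          ≤ A * ∑' n, x n * (1 - c * (1 - ρ)) ^ (2 * n)) →
      ∀ M, ∑ n ∈ Finset.range M, y n * b n ≤ B * ∑' n, x n * b n := by
  obtain ⟨G, hG, hmix⟩ := exists_mixture_le hb hpos hE hhalf hc hc1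
  refine ⟨2 * A * G, by positivity, fun x y hx hy hxb hxy M => ?_⟩
  refine (Finset.sum_le_sum_of_subset_of_nonneg
    (Finset.range_mono (Nat.le_succ M)) fun n _ _ => mul_nonneg (hy n) (hpos n).le).trans ?_
  set R : ℕ → ℝ := fun N => 1 - c * (1 / (4 * ((N : ℝ) + 1))) with hR
  have hΔ : ∀ N, 0 ≤ b N - b (N + 1) := fun N => sub_nonneg.2 (hb (Nat.le_succ N))
  have key : ∀ N : ℕ, Summable (fun n => x n * R N ^ (2 * n)) ∧
      ∑ n ∈ Finset.range (N + 1), y n ≤ 2 * A * ∑' n, x n * R N ^ (2 * n) := fun N => by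
    have hN : (0 : ℝ) ≤ N := Nat.cast_nonneg N
    set t : ℝ := 1 / (4 * ((N : ℝ) + 1)) with ht
    have ht0 : 0 < t := by positivity
    have ht4 : t * (4 * ((N : ℝ) + 1)) = 1 := by rw [ht]; field_simp
    have ht1 : t < 1 := by nlinarith
    obtain ⟨h1, h2⟩ := hxy (1 - t) (by linarith) (by linarith)
    have hR' : 1 - c * (1 - (1 - t)) = R N := by simp only [hR, ht]; ring
    rw [hR'] at h1 h2
    refine ⟨h1, ?_⟩
    have h3 : ∀ n ∈ Finset.range (N + 1), y n ≤ 2 * (y n * (1 - t) ^ (2 * n)) := fun n hn => by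
      have hn' : (n : ℝ) ≤ N := by exact_mod_cast Nat.lt_succ_iff.1 (Finset.mem_range.1 hn)
      have h4 := one_add_mul_le_pow (a := -t) (by linarith) (2 * n)
      -- by Bernoulli's inequality, as `2 n t ≤ 2 N / (4 (N + 1)) ≤ 1 / 2`
      have h5 : 1 / 2 ≤ (1 - t) ^ (2 * n) := by
        rw [sub_eq_add_neg]
        refine le_trans ?_ h4
        push_cast
        nlinarith
      nlinarith [hy n]
    calc ∑ n ∈ Finset.range (N + 1), y n
        ≤ ∑ n ∈ Finset.range (N + 1), 2 * (y n * (1 - t) ^ (2 * n)) := Finset.sum_le_sum h3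
      _ = 2 * ∑ n ∈ Finset.range (N + 1), y n * (1 - t) ^ (2 * n) := by rw [Finset.mul_sum]
      _ ≤ 2 * (A * ∑' n, x n * R N ^ (2 * n)) := by linarith [h2 (N + 1)]
      _ = _ := by ring
  rw [sum_mul_eq_sum_sub_mul_sum]
  have hsum : ∀ (w : ℝ) (N : ℕ), Summable fun n => w * (x n * R N ^ (2 * n)) := fun w N =>
    (key N).1.mul_left w
  calc ∑ N ∈ Finset.range M, (b N - b (N + 1)) * ∑ n ∈ Finset.range (N + 1), y n
        + b M * ∑ n ∈ Finset.range (M + 1), y n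
      ≤ ∑ N ∈ Finset.range M, (b N - b (N + 1)) * (2 * A * ∑' n, x n * R N ^ (2 * n))
        + b M * (2 * A * ∑' n, x n * R M ^ (2 * n)) :=
        add_le_add (Finset.sum_le_sum fun N _ => mul_le_mul_of_nonneg_left (key N).2 (hΔ N))
          (mul_le_mul_of_nonneg_left (key M).2 (hpos M).le)
    _ = 2 * A * ∑' n, (∑ N ∈ Finset.range M, (b N - b (N + 1)) * (x n * R N ^ (2 * n))
          + b M * (x n * R M ^ (2 * n))) := by
        rw [Summable.tsum_add (summable_sum fun N _ => hsum _ N) (hsum _ M),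
          Summable.tsum_finsetSum fun N _ => hsum _ N, mul_add, Finset.mul_sum]
        simp_rw [tsum_mul_left]
        congr 1
        · exact Finset.sum_congr rfl fun N _ => by ring
        · ring
    _ ≤ 2 * A * ∑' n, G * (x n * b n) := by
        refine mul_le_mul_of_nonneg_left (Summable.tsum_le_tsum (fun n => ?_)
          ((summable_sum fun N _ => hsum _ N).add (hsum _ M)) (hxb.mul_left G)) (by positivity)
        have := mul_le_mul_of_nonneg_left (hmix M n) (hx n)
        calc _ = x n * (∑ N ∈ Finset.range M, (b N - b (N + 1)) * R N ^ (2 * n)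
              + b M * R M ^ (2 * n)) := by
              rw [mul_add, Finset.mul_sum]
              congr 1
              · exact Finset.sum_congr rfl fun N _ => by ring
              · ring
          _ ≤ _ := this
          _ = _ := by ring
    _ = 2 * A * G * ∑' n, x n * b n := by rw [tsum_mul_left]; ring

/-! ### Square means over circles -/

theorem sphere_abs_subset_ball {ρ : ℝ} (hρ : 0 < ρ) (hρ1 : ρ < 1) :
    Metric.sphere (0 : ℂ) |ρ| ⊆ Metric.ball 0 1 := by
  rw [abs_of_pos hρ]
  exact Metric.sphere_subset_closedBall.trans (Metric.closedBall_subset_ball hρ1)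

theorem circleIntegrable_of_continuousOn_ball {E : Type*} [NormedAddCommGroup E] {F : ℂ → E}
    (hF : ContinuousOn F (Metric.ball 0 1)) {ρ : ℝ} (hρ : 0 < ρ) (hρ1 : ρ < 1) :
    CircleIntegrable F 0 ρ :=
  (hF.mono (sphere_abs_subset_ball hρ hρ1)).circleIntegrable'

/-- Cauchy's formula for the Taylor coefficients, with the power of `z` moved to the conjugate. -/
theorem circleAverage_conj_mul_pow {F : ℂ → ℂ} (hF : DifferentiableOn ℂ F (Metric.ball 0 1))
    {ρ : ℝ} (hρ : 0 < ρ) (hρ1 : ρ < 1) (n : ℕ) :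
    Real.circleAverage (fun z => conj (F z) * z ^ n) 0 ρ
      = conj (iteratedDeriv n F 0 / (n.factorial : ℂ)) * (ρ : ℂ) ^ (2 * n) := by
  have hFc : DifferentiableOn ℂ F (Metric.closedBall 0 ρ) :=
    hF.mono (Metric.closedBall_subset_ball hρ1)
  have hd : DiffContOnCl ℂ F (Metric.ball 0 ρ) := by
    refine DifferentiableOn.diffContOnCl ?_
    rwa [closure_ball _ hρ.ne']
  have h1 := hd.circleIntegral_one_div_sub_center_pow_smul hρ n
  have h2 : Real.circleAverage (fun z => F z * (z ^ n)⁻¹) 0 ρ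
      = iteratedDeriv n F 0 / (n.factorial : ℂ) := by
    rw [Real.circleAverage_eq_circleIntegral hρ.ne']
    have h3 : ∮ z in C(0, ρ), (z - 0)⁻¹ • (F z * (z ^ n)⁻¹)
        = ∮ z in C(0, ρ), (1 / (z - 0) ^ (n + 1)) • F z := by
      refine circleIntegral.integral_congr hρ.le fun z _ => ?_
      simp only [sub_zero, smul_eq_mul, one_div, pow_succ, mul_inv]
      ring
    rw [h3, h1]
    have : (2 * (Real.pi : ℂ) * Complex.I) ≠ 0 := Complex.two_pi_I_ne_zero
    simp only [smul_eq_mul]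
    field_simp
  have hint : CircleIntegrable (fun z => F z * (z ^ n)⁻¹) 0 ρ := by
    refine ContinuousOn.circleIntegrable' ?_
    refine (hF.continuousOn.mono (sphere_abs_subset_ball hρ hρ1)).mul
      ((continuousOn_id.pow n).inv₀ fun z hz => pow_ne_zero _ ?_)
    rintro rfl
    rw [abs_of_pos hρ, mem_sphere_zero_iff_norm, norm_zero] at hz
    exact hρ.ne hz
  have h4 := (Complex.conjCLE.toContinuousLinearMap).circleAverage_comp_comm hint
  rw [h2] at h4
  have h5 : Real.circleAverage (fun z => conj (F z) * z ^ n) 0 ρ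
      = Real.circleAverage (((ρ : ℂ) ^ (2 * n)) •
        (Complex.conjCLE.toContinuousLinearMap ∘ fun z => F z * (z ^ n)⁻¹)) 0 ρ := by
    refine Real.circleAverage_congr_sphere fun z hz => ?_
    rw [abs_of_pos hρ, mem_sphere_zero_iff_norm] at hz
    have hz0 : z ≠ 0 := by rintro rfl; exact hρ.ne (by simpa using hz)
    have hzz : (ρ : ℂ) ^ (2 * n) = z ^ n * conj z ^ n := by
      rw [← mul_pow, Complex.mul_conj', hz, ← pow_mul]
    have hc : conj z ≠ 0 := by simpa using hz0
    simp only [Pi.smul_apply, Function.comp_apply, smul_eq_mul, hzz,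
      ContinuousLinearEquiv.coe_coe, Complex.conjCLE_apply, map_mul, map_inv₀, map_pow]
    field_simp
  rw [h5, Real.circleAverage_smul, h4]
  simp [mul_comm]

/-- Parseval's formula on the circle of radius `ρ`. -/
theorem hasSum_circleAverage_norm_sq {F : ℂ → ℂ} (hF : DifferentiableOn ℂ F (Metric.ball 0 1))
    {ρ : ℝ} (hρ : 0 < ρ) (hρ1 : ρ < 1) :
    HasSum (fun n => ‖iteratedDeriv n F 0 / (n.factorial : ℂ)‖ ^ 2 * ρ ^ (2 * n))
      (Real.circleAverage (fun z => ‖F z‖ ^ 2) 0 ρ) := by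
  set a : ℕ → ℂ := fun n => iteratedDeriv n F 0 / (n.factorial : ℂ) with ha
  have hT : ∀ z ∈ Metric.ball (0 : ℂ) 1, HasSum (fun n => a n * z ^ n) (F z) := fun z hz => by
    have h := Complex.hasSum_taylorSeries_on_ball (r := 1) hF hz
    have e : (fun n => a n * z ^ n) = fun n : ℕ =>
        (n.factorial : ℂ)⁻¹ • (z - 0) ^ n • iteratedDeriv n F 0 := by
      funext n
      simp only [ha, sub_zero, smul_eq_mul, div_eq_inv_mul]
      ring
    rwa [e]
  have hsub := sphere_abs_subset_ball hρ hρ1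
  have hmem : ∀ θ : ℝ, circleMap 0 ρ θ ∈ Metric.ball (0 : ℂ) 1 := fun θ =>
    hsub (circleMap_mem_sphere' _ _ _)
  have hsum : Summable fun n => ‖a n‖ * ρ ^ n := by
    have h := (hT ρ (by simpa [abs_of_pos hρ] using hρ1)).summable.norm
    simpa only [norm_mul, norm_pow, Complex.norm_real, Real.norm_of_nonneg hρ.le] using h
  obtain ⟨M, hM⟩ := (isCompact_closedBall (0 : ℂ) ρ).exists_bound_of_continuousOn
    (hF.continuousOn.mono (Metric.closedBall_subset_ball hρ1))
  have hFθ : Continuous fun θ : ℝ => F (circleMap 0 ρ θ) := by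
    rw [← continuousOn_univ]
    exact hF.continuousOn.comp (continuous_circleMap 0 ρ).continuousOn fun θ _ => hmem θ
  have hnorm : ∀ θ : ℝ, ‖circleMap 0 ρ θ‖ = ρ := fun θ => by simp [abs_of_pos hρ]
  have h1 : HasSum (fun n => Real.circleAverage (fun z => conj (F z) * (a n * z ^ n)) 0 ρ)
      (Real.circleAverage (fun z => conj (F z) * F z) 0 ρ) := by
    simp only [Real.circleAverage_def]
    refine HasSum.const_smul _ ?_
    refine intervalIntegral.hasSum_integral_of_dominated_convergence
      (fun n _ => M * (‖a n‖ * ρ ^ n)) (fun n => ?_) (fun n => ?_) ?_ ?_ ?_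
    · exact ((Complex.continuous_conj.comp hFθ).mul
        (continuous_const.mul ((continuous_circleMap 0 ρ).pow n))).aestronglyMeasurable
    · refine Filter.Eventually.of_forall fun θ _ => ?_
      rw [norm_mul, norm_mul, norm_pow, RCLike.norm_conj, hnorm]
      refine mul_le_mul_of_nonneg_right (hM _ ?_) (by positivity)
      simp [abs_of_pos hρ]
    · exact Filter.Eventually.of_forall fun θ _ => hsum.mul_left M
    · exact intervalIntegrable_const
    · exact Filter.Eventually.of_forall fun θ _ => (hT _ (hmem θ)).mul_left _
  have h2 : ∀ n, Real.circleAverage (fun z => conj (F z) * (a n * z ^ n)) 0 ρ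
      = ((‖a n‖ ^ 2 * ρ ^ (2 * n) : ℝ) : ℂ) := fun n => by
    have h3 : (fun z => conj (F z) * (a n * z ^ n)) = a n • fun z => conj (F z) * z ^ n := by
      funext z
      simp only [Pi.smul_apply, smul_eq_mul]
      ring
    rw [h3, Real.circleAverage_smul, circleAverage_conj_mul_pow hF hρ hρ1, smul_eq_mul, ← mul_assoc,
      Complex.mul_conj']
    push_cast
    rfl
  have h4 : Real.circleAverage (fun z => conj (F z) * F z) 0 ρ
      = ((Real.circleAverage (fun z => ‖F z‖ ^ 2) 0 ρ : ℝ) : ℂ) := by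
    have h5 := Complex.ofRealCLM.circleAverage_comp_comm (f := fun z => ‖F z‖ ^ 2)
      (circleIntegrable_of_continuousOn_ball (hF.continuousOn.norm.pow 2) hρ hρ1)
    rw [Complex.ofRealCLM_apply] at h5
    rw [← h5]
    congr 1
    funext z
    simp [Complex.conj_mul']
  simp only [h2] at h1
  rw [h4] at h1
  exact Complex.hasSum_ofReal.1 h1

/-- The square of the modulus of an analytic function is dominated by its Poisson integral. -/
theorem norm_sq_le_poisson {F : ℂ → ℂ} (hF : DifferentiableOn ℂ F (Metric.ball 0 1))
    {R : ℝ} (hR : 0 < R) (hR1 : R < 1) {w : ℂ} (hw : w ∈ Metric.ball (0 : ℂ) R) :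
    ‖F w‖ ^ 2 ≤ Real.circleAverage ((Complex.re ∘ herglotzRieszKernel 0 w) • fun z => ‖F z‖ ^ 2)
      0 R := by
  have hd : DiffContOnCl ℂ (fun z => F z ^ 2) (Metric.ball 0 R) := by
    refine DifferentiableOn.diffContOnCl ?_
    rw [closure_ball _ hR.ne']
    exact (hF.mono (Metric.closedBall_subset_ball hR1)).pow 2
  have h1 := hd.circleAverage_re_herglotzRieszKernel_smul hw
  have h2 : ‖F w‖ ^ 2 = ‖Real.circleAverage
      ((Complex.re ∘ herglotzRieszKernel 0 w) • fun z => F z ^ 2) 0 R‖ := by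
    rw [h1, norm_pow]
  rw [h2, Real.circleAverage_def, Real.circleAverage_def, norm_smul, smul_eq_mul,
    Real.norm_of_nonneg (by positivity)]
  refine mul_le_mul_of_nonneg_left ?_ (by positivity)
  refine (intervalIntegral.norm_integral_le_integral_norm (by positivity)).trans_eq ?_
  refine intervalIntegral.integral_congr fun θ _ => ?_
  have hz : circleMap 0 R θ ∈ Metric.sphere (0 : ℂ) R := circleMap_mem_sphere _ hR.le _
  have h3 := le_re_herglotzRieszKernel hz hw
  have hw' : ‖w‖ < R := by simpa using hw
  have h4 : 0 ≤ (herglotzRieszKernel 0 w (circleMap 0 R θ)).re := by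
    refine le_trans ?_ h3
    simp only [sub_zero]
    exact div_nonneg (by linarith) (by positivity)
  simp [abs_of_nonneg h4]

/-- Littlewood's subordination principle, in the form of a comparison of square means: if `φ` maps
the closed disk of radius `ρ` into the open disk of radius `R`, the Herglotz integral `H` of `|F|²`
over the circle of radius `R` satisfies `|F ∘ φ|² ≤ re (H ∘ φ)`, and the mean of `re (H ∘ φ)` is its
value at `0`. -/
theorem circleAverage_comp_le {F φ : ℂ → ℂ} (hF : DifferentiableOn ℂ F (Metric.ball 0 1))
    (hφ : DifferentiableOn ℂ φ (Metric.ball 0 1)) {ρ R : ℝ} (hρ : 0 < ρ) (hρ1 : ρ < 1)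
    (hR : 0 < R) (hR1 : R < 1)
    (hmaps : Set.MapsTo φ (Metric.closedBall 0 ρ) (Metric.ball 0 R)) :
    Real.circleAverage (fun z => ‖F (φ z)‖ ^ 2) 0 ρ
      ≤ (R + ‖φ 0‖) / (R - ‖φ 0‖) * Real.circleAverage (fun z => ‖F z‖ ^ 2) 0 R := by
  set g : ℂ → ℝ := fun z => ‖F z‖ ^ 2 with hg
  have hgi : CircleIntegrable g 0 R :=
    circleIntegrable_of_continuousOn_ball (hF.continuousOn.norm.pow 2) hR hR1
  have hgi' : CircleIntegrable (fun ζ => (g ζ : ℂ)) 0 R :=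
    circleIntegrable_of_continuousOn_ball
      (Complex.continuous_ofReal.comp_continuousOn (hF.continuousOn.norm.pow 2)) hR hR1
  set H : ℂ → ℂ := fun w =>
    Real.circleAverage (fun ζ => herglotzRieszKernel 0 w ζ • (g ζ : ℂ)) 0 R with hH
  have hHd : DifferentiableOn ℂ H (Metric.ball 0 R) :=
    differentiableOn_circleAverage_herglotzRieszKernel_smul hgi'
  have hHre : ∀ w ∈ Metric.ball (0 : ℂ) R, (H w).re
      = Real.circleAverage ((Complex.re ∘ herglotzRieszKernel 0 w) • g) 0 R := fun w hw =>
    re_circleAverage_herglotzRieszKernel_smul hgi hw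
  have hHφ : DifferentiableOn ℂ (H ∘ φ) (Metric.closedBall 0 ρ) :=
    hHd.comp (hφ.mono (Metric.closedBall_subset_ball hρ1)) hmaps
  have hmean : Real.circleAverage (H ∘ φ) 0 ρ = H (φ 0) := by
    refine DiffContOnCl.circleAverage (f := H ∘ φ) (DifferentiableOn.diffContOnCl ?_)
    rwa [abs_of_pos hρ, closure_ball _ hρ.ne']
  have hsphere : Metric.sphere (0 : ℂ) |ρ| ⊆ Metric.closedBall 0 ρ := by
    rw [abs_of_pos hρ]
    exact Metric.sphere_subset_closedBall
  have hHint : CircleIntegrable (H ∘ φ) 0 ρ := (hHφ.continuousOn.mono hsphere).circleIntegrable'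
  have hmean' := Complex.reCLM.circleAverage_comp_comm hHint
  rw [hmean, Complex.reCLM_apply] at hmean'
  have hφ0 : φ 0 ∈ Metric.ball (0 : ℂ) R := hmaps (by simp [hρ.le])
  have hcomp : ContinuousOn (fun z => ‖F (φ z)‖ ^ 2) (Metric.sphere (0 : ℂ) |ρ|) := by
    refine ContinuousOn.pow (ContinuousOn.norm (hF.continuousOn.comp
      (hφ.continuousOn.mono (sphere_abs_subset_ball hρ hρ1)) fun z hz => ?_)) 2
    exact Metric.ball_subset_ball hR1.le (hmaps (hsphere hz))
  calc Real.circleAverage (fun z => ‖F (φ z)‖ ^ 2) 0 ρ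
      ≤ Real.circleAverage (Complex.reCLM ∘ (H ∘ φ)) 0 ρ := by
        refine Real.circleAverage_mono hcomp.circleIntegrable' ?_ fun z hz => ?_
        · exact (Complex.reCLM.continuous.comp_continuousOn
            (hHφ.continuousOn.mono hsphere)).circleIntegrable'
        · have hz' := hmaps (hsphere hz)
          simp only [Function.comp_apply, Complex.reCLM_apply]
          rw [hHre _ hz']
          exact norm_sq_le_poisson hF hR hR1 hz'
    _ = Real.circleAverage ((Complex.re ∘ herglotzRieszKernel 0 (φ 0)) • g) 0 R := by
        rw [hmean', hHre _ hφ0]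
    _ ≤ Real.circleAverage (((R + ‖φ 0‖) / (R - ‖φ 0‖)) • g) 0 R := by
        have hker : ContinuousOn (Complex.re ∘ herglotzRieszKernel 0 (φ 0))
            (Metric.sphere (0 : ℂ) |R|) :=
          Complex.continuous_re.comp_continuousOn (continuousOn_herglotzRieszKernel_sphere hφ0)
        have hgc : ContinuousOn g (Metric.sphere (0 : ℂ) |R|) :=
          (hF.continuousOn.norm.pow 2).mono (sphere_abs_subset_ball hR hR1)
        refine Real.circleAverage_mono (hker.smul hgc).circleIntegrable'
          (hgc.const_smul _).circleIntegrable' fun z hz => ?_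
        rw [abs_of_pos hR] at hz
        have := re_herglotzRieszKernel_le hz hφ0
        simp only [sub_zero] at this
        simp only [Pi.smul_apply', Pi.smul_apply, Function.comp_apply, smul_eq_mul,
          herglotzRieszKernel_def, sub_zero]
        exact mul_le_mul_of_nonneg_right this (by simp only [hg]; positivity)
    _ = _ := by rw [Real.circleAverage_smul, smul_eq_mul]

/-- A consequence of the Schwarz–Pick lemma: analytic self-maps of the disk do not approach the
unit circle faster than their argument does, up to a constant. -/
theorem le_one_sub_norm_of_mapsTo {φ : ℂ → ℂ} (hφ : DifferentiableOn ℂ φ (Metric.ball 0 1))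
    (hmaps : Set.MapsTo φ (Metric.ball 0 1) (Metric.ball 0 1)) {z : ℂ}
    (hz : z ∈ Metric.ball (0 : ℂ) 1) :
    (1 - ‖φ 0‖) / 4 * (1 - ‖z‖) ≤ 1 - ‖φ z‖ := by
  set a := φ 0 with ha
  have hlt : ∀ z ∈ Metric.ball (0 : ℂ) 1, ‖φ z‖ < 1 := fun z hz => by simpa using hmaps hz
  have ha1 : ‖a‖ < 1 := hlt 0 (by simp)
  have hre : ∀ w : ℂ, ‖w‖ < 1 → 1 - ‖a‖ ≤ ‖1 - conj a * w‖ := fun w hw => by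
    have h1 : ‖(1 : ℂ)‖ - ‖conj a * w‖ ≤ ‖1 - conj a * w‖ := norm_sub_norm_le _ _
    rw [norm_one, norm_mul, RCLike.norm_conj] at h1
    nlinarith [norm_nonneg a, norm_nonneg w]
  have hid : ∀ w : ℂ, ‖1 - conj a * w‖ ^ 2 - ‖w - a‖ ^ 2 = (1 - ‖a‖ ^ 2) * (1 - ‖w‖ ^ 2) :=
    fun w => by
      simp only [← Complex.normSq_eq_norm_sq, Complex.normSq_apply]
      simp
      ring
  have hne : ∀ w : ℂ, ‖w‖ < 1 → 1 - conj a * w ≠ 0 := fun w hw => by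
    rw [← norm_pos_iff]
    linarith [hre w hw]
  have hschwarz : ‖(φ z - a) / (1 - conj a * φ z)‖ ≤ ‖z‖ := by
    refine Complex.norm_le_norm_of_mapsTo_ball
      (f := fun z => (φ z - a) / (1 - conj a * φ z)) (R := 1) ?_ ?_ ?_ (by simpa using hz)
    · exact (hφ.sub_const a).div ((hφ.const_mul _).const_sub 1) fun z hz => hne _ (hlt z hz)
    · intro z hz
      have h1 := hlt z hz
      have h2 := hid (φ z)
      have h3 : 0 ≤ (1 - ‖a‖ ^ 2) * (1 - ‖φ z‖ ^ 2) :=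
        mul_nonneg (by nlinarith [norm_nonneg a]) (by nlinarith [norm_nonneg (φ z)])
      rw [mem_closedBall_zero_iff, norm_div, div_le_one (norm_pos_iff.2 (hne _ h1))]
      exact le_of_sq_le_sq (by linarith) (norm_nonneg _)
    · simp [ha]
  have hw := hlt z hz
  have hz1 : ‖z‖ < 1 := by simpa using hz
  rw [norm_div, div_le_iff₀ (norm_pos_iff.2 (hne _ hw))] at hschwarz
  have h1 := hid (φ z)
  have h2 := hre _ hw
  set N := ‖1 - conj a * φ z‖
  set r := ‖z‖
  have hr : 0 ≤ r := norm_nonneg z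
  have hA : 0 ≤ ‖a‖ := norm_nonneg a
  have hW : 0 ≤ ‖φ z‖ := norm_nonneg _
  have h3 : ‖φ z - a‖ ^ 2 ≤ r ^ 2 * N ^ 2 := by
    rw [← mul_pow]
    exact pow_le_pow_left₀ (norm_nonneg _) hschwarz 2
  have h4 : (1 - ‖a‖) ^ 2 ≤ N ^ 2 := pow_le_pow_left₀ (by linarith) h2 2
  have h5 : (1 - r ^ 2) * (1 - ‖a‖) ^ 2 ≤ (1 - ‖a‖ ^ 2) * (1 - ‖φ z‖ ^ 2) := by
    have : 0 ≤ 1 - r ^ 2 := by nlinarith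
    nlinarith [mul_le_mul_of_nonneg_left h4 this]
  have h6 : (1 - r ^ 2) * (1 - ‖a‖) ≤ (1 + ‖a‖) * (1 - ‖φ z‖ ^ 2) := by
    have : 0 < 1 - ‖a‖ := by linarith
    refine le_of_mul_le_mul_right ?_ this
    nlinarith
  have h7 : (1 + ‖a‖) * (1 - ‖φ z‖ ^ 2) ≤ 4 * (1 - ‖φ z‖) := by
    have h8 : (1 + ‖a‖) * (1 + ‖φ z‖) ≤ 2 * 2 :=
      mul_le_mul (by linarith) (by linarith) (by linarith) (by norm_num)
    nlinarith [mul_le_mul_of_nonneg_right h8 (by linarith : 0 ≤ 1 - ‖φ z‖)]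
  have h8 : (1 - r) * (1 - ‖a‖) ≤ (1 - r ^ 2) * (1 - ‖a‖) :=
    mul_le_mul_of_nonneg_right (by nlinarith) (by linarith)
  nlinarith

/-! ### Analytic functions on the disk -/

theorem extend_eqOn {f : 𝔻 → ℂ} {F : ℂ → ℂ} (h : ∀ z : 𝔻, f z = F z) :
    Set.EqOn (extend f) F (Metric.ball 0 1) := fun z hz => by
  have hz' : ‖z‖ < 1 := by simpa using hz
  simp [extend, hz', h]

theorem isHolo_of_eq {f : 𝔻 → ℂ} {F : ℂ → ℂ} (h : ∀ z : 𝔻, f z = F z)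
    (hF : DifferentiableOn ℂ F (Metric.ball 0 1)) : IsHolo f :=
  hF.congr (extend_eqOn h)

/-- A sequence that grows slower than every geometric one is the sequence of the Taylor coefficients
of an analytic function on the disk. -/
theorem exists_isHolo_coeff_eq {a : ℕ → ℂ}
    (ha : ∀ r : ℝ, 0 ≤ r → r < 1 → Summable fun n => ‖a n‖ * r ^ n) :
    ∃ f : 𝔻 → ℂ, IsHolo f ∧ ∀ n, coeff f n = a n := by
  set F : ℂ → ℂ := fun z => ∑' n, a n * z ^ n with hF
  have hs : HasFPowerSeriesOnBall F (.ofScalars ℂ a) 0 1 := by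
    refine ⟨le_of_forall_lt_imp_le_of_dense fun r hr => ?_, by simp, fun {y} hy => ?_⟩
    · lift r to NNReal using hr.ne_top
      refine FormalMultilinearSeries.le_radius_of_summable _ ?_
      simpa using ha r r.2 (by exact_mod_cast hr)
    · rw [← ENNReal.coe_one, Metric.eball_coe, NNReal.coe_one, mem_ball_zero_iff] at hy
      have h1 : Summable fun n => a n * y ^ n :=
        Summable.of_norm (by simpa using ha ‖y‖ (norm_nonneg y) hy)
      simpa [hF, mul_comm] using h1.hasSum
  have hFd : DifferentiableOn ℂ F (Metric.ball 0 1) := by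
    have := hs.differentiableOn
    rwa [← ENNReal.coe_one, Metric.eball_coe, NNReal.coe_one] at this
  refine ⟨fun z => F z, isHolo_of_eq (fun _ => rfl) hFd, fun n => ?_⟩
  have hev : extend (fun z : 𝔻 => F z) =ᶠ[nhds 0] F :=
    (extend_eqOn fun _ => rfl).eventuallyEq_of_mem (Metric.ball_mem_nhds 0 one_pos)
  rw [coeff, hev.iteratedDeriv_eq]
  have h2 := hs.hasFPowerSeriesAt.eq_formalMultilinearSeries
    hs.hasFPowerSeriesAt.analyticAt.hasFPowerSeriesAt
  exact (congrFun (FormalMultilinearSeries.ofScalars_series_injective ℂ ℂ h2) n).symm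

theorem hasSum_norm_sq_coeff {f : 𝔻 → ℂ} (hf : IsHolo f) {ρ : ℝ} (hρ : 0 < ρ) (hρ1 : ρ < 1) :
    HasSum (fun n => ‖coeff f n‖ ^ 2 * ρ ^ (2 * n))
      (Real.circleAverage (fun z => ‖extend f z‖ ^ 2) 0 ρ) :=
  hasSum_circleAverage_norm_sq hf hρ hρ1

/-- Bounds for square means over circles give bounds for the norm of `H²(β)`. -/
theorem exists_weighted_bound {β : ℕ → {x : ℝ // 0 < x}} (hβ : EssentiallyDecreasing β)
    (hΔ : DeltaTwo β) {c : ℝ} (hc : 0 < c) (hc1 : c ≤ 1) {A : ℝ} (hA : 0 ≤ A) :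
    ∃ B : ℝ, 0 ≤ B ∧ ∀ f g : 𝔻 → ℂ, IsHolo f → IsHolo g →
      (Summable fun n => ‖coeff f n‖ ^ 2 * (β n : ℝ)) →
      (∀ ρ : ℝ, 0 < ρ → ρ < 1 → Real.circleAverage (fun z => ‖extend g z‖ ^ 2) 0 ρ
        ≤ A * Real.circleAverage (fun z => ‖extend f z‖ ^ 2) 0 (1 - c * (1 - ρ))) →
      (Summable fun n => ‖coeff g n‖ ^ 2 * (β n : ℝ)) ∧
        ∑' n, ‖coeff g n‖ ^ 2 * (β n : ℝ) ≤ B * ∑' n, ‖coeff f n‖ ^ 2 * (β n : ℝ) := by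
  obtain ⟨b, C, E, hC, hE, hb, hhalf, hbβ⟩ := exists_antitone_envelope hβ hΔ
  have hpos : ∀ n, 0 < b n := fun n => (β n).2.trans_le (hbβ n).1
  obtain ⟨B, hB, hbound⟩ := exists_weighted_sum_le hb hpos hE hhalf hc hc1 hA
  refine ⟨B * C, by positivity, fun f g hf hg hfβ hmean => ?_⟩
  have hle : ∀ n, ‖coeff f n‖ ^ 2 * b n ≤ C * (‖coeff f n‖ ^ 2 * (β n : ℝ)) := fun n => by
    have := mul_le_mul_of_nonneg_left (hbβ n).2 (sq_nonneg ‖coeff f n‖)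
    linarith
  have hfb : Summable fun n => ‖coeff f n‖ ^ 2 * b n :=
    Summable.of_nonneg_of_le (fun n => mul_nonneg (sq_nonneg _) (hpos n).le) hle (hfβ.mul_left C)
  have h1 := hbound (fun n => ‖coeff f n‖ ^ 2) (fun n => ‖coeff g n‖ ^ 2) (fun n => sq_nonneg _)
    (fun n => sq_nonneg _) hfb fun ρ hρ hρ1 => by
      have hf' := hasSum_norm_sq_coeff hf (ρ := 1 - c * (1 - ρ)) (by nlinarith) (by nlinarith)
      have hg' := hasSum_norm_sq_coeff hg hρ hρ1
      refine ⟨hf'.summable, fun N => ?_⟩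
      rw [hf'.tsum_eq]
      refine le_trans ?_ (hmean ρ hρ hρ1)
      exact sum_le_hasSum _ (fun n _ => by positivity) hg'
  have hg0 : ∀ n, 0 ≤ ‖coeff g n‖ ^ 2 * (β n : ℝ) := fun n =>
    mul_nonneg (sq_nonneg _) (β n).2.le
  have h2 : ∀ M, ∑ n ∈ Finset.range M, ‖coeff g n‖ ^ 2 * (β n : ℝ)
      ≤ B * C * ∑' n, ‖coeff f n‖ ^ 2 * (β n : ℝ) := fun M => by
    calc ∑ n ∈ Finset.range M, ‖coeff g n‖ ^ 2 * (β n : ℝ)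
        ≤ ∑ n ∈ Finset.range M, ‖coeff g n‖ ^ 2 * b n := Finset.sum_le_sum fun n _ =>
          mul_le_mul_of_nonneg_left (hbβ n).1 (sq_nonneg _)
      _ ≤ B * ∑' n, ‖coeff f n‖ ^ 2 * b n := h1 M
      _ ≤ B * ∑' n, C * (‖coeff f n‖ ^ 2 * (β n : ℝ)) :=
          mul_le_mul_of_nonneg_left (Summable.tsum_le_tsum hle hfb (hfβ.mul_left C)) hB
      _ = _ := by rw [tsum_mul_left]; ring
  exact ⟨summable_of_sum_range_le hg0 h2, Real.tsum_le_of_sum_range_le hg0 h2⟩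

/-! ### Operators between weighted Hardy spaces -/

/-- A linear map of functions that is bounded in terms of Taylor coefficients induces a bounded
operator. -/
theorem exists_operator {β γ : ℕ → {x : ℝ // 0 < x}} (T : (𝔻 → ℂ) →ₗ[ℂ] (𝔻 → ℂ)) {B : ℝ}
    (hB : 0 ≤ B) (hT : ∀ f : 𝔻 → ℂ, IsHolo f → (Summable fun n => ‖coeff f n‖ ^ 2 * (γ n : ℝ)) →
      IsHolo (T f) ∧ (Summable fun n => ‖coeff (T f) n‖ ^ 2 * (β n : ℝ)) ∧
        ∑' n, ‖coeff (T f) n‖ ^ 2 * (β n : ℝ) ≤ B * ∑' n, ‖coeff f n‖ ^ 2 * (γ n : ℝ)) :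
    ∃ S : WeightedHardy γ →L[ℂ] WeightedHardy β,
      ∀ f, WeightedHardy.toFun β (S f) = T (WeightedHardy.toFun γ f) := by
  have h : ∀ f : WeightedHardy γ, _ := fun f =>
    hT (WeightedHardy.toFun γ f) (WeightedHardy.isHolo γ f) (WeightedHardy.summable γ f)
  let S : WeightedHardy γ →ₗ[ℂ] WeightedHardy β :=
    { toFun := fun f => ⟨T (WeightedHardy.toFun γ f), (h f).1, (h f).2.1⟩
      map_add' := fun f g => Subtype.ext
        ((congrArg T (map_add (WeightedHardy.toFun γ) f g)).trans (map_add T _ _))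
      map_smul' := fun c f => Subtype.ext
        ((congrArg T (map_smul (WeightedHardy.toFun γ) c f)).trans (map_smul T _ _)) }
  have hS : ∀ f, WeightedHardy.toFun β (S f) = T (WeightedHardy.toFun γ f) := fun f => rfl
  refine ⟨S.mkContinuous (Real.sqrt B) fun f => ?_, hS⟩
  refine le_of_sq_le_sq ?_ (by positivity)
  rw [mul_pow, Real.sq_sqrt hB, WeightedHardy.norm_sq_eq, WeightedHardy.norm_sq_eq, hS]
  exact (h f).2.2

theorem extend_mul (f g : 𝔻 → ℂ) : extend (f * g) = extend f * extend g := by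
  funext z; by_cases hz : ‖z‖ < 1 <;> simp [extend, hz]

/-- Multiplication by a bounded analytic function is bounded on `H²(β)`. -/
theorem exists_mul_operator {β : ℕ → {x : ℝ // 0 < x}} (hβ : EssentiallyDecreasing β)
    (hΔ : DeltaTwo β) {w : 𝔻 → ℂ} (hw : w ∈ HInfty) :
    ∃ S : WeightedHardy β →L[ℂ] WeightedHardy β,
      ∀ f, WeightedHardy.toFun β (S f) = w * WeightedHardy.toFun β f := by
  obtain ⟨hwh, M, hM⟩ := hw
  obtain ⟨B, hB, hbound⟩ := exists_weighted_bound hβ hΔ one_pos le_rfl (sq_nonneg M)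
  have hM0 : 0 ≤ M := (norm_nonneg _).trans (hM 0)
  refine exists_operator (LinearMap.mulLeft ℂ w) hB fun f hf hfβ => ?_
  have hwf : IsHolo (w * f) := by
    rw [IsHolo, extend_mul]
    exact DifferentiableOn.mul hwh hf
  refine ⟨hwf, hbound f _ hf hwf hfβ fun ρ hρ hρ1 => ?_⟩
  rw [one_mul, sub_sub_cancel, ← smul_eq_mul, ← Real.circleAverage_fun_smul]
  refine Real.circleAverage_mono
    (circleIntegrable_of_continuousOn_ball (hwf.continuousOn.norm.pow 2) hρ hρ1)
    (circleIntegrable_of_continuousOn_ball (F := fun z => M ^ 2 • ‖extend f z‖ ^ 2)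
      (by have := hf.continuousOn; fun_prop) hρ hρ1)
    fun z hz => ?_
  have hz' : ‖z‖ < 1 := by simpa using sphere_abs_subset_ball hρ hρ1 hz
  have hwz : ‖extend w z‖ ≤ M := by simpa [extend, hz'] using hM _
  simp only [LinearMap.mulLeft_apply, extend_mul, Pi.mul_apply, norm_mul, mul_pow, smul_eq_mul]
  gcongr

/-- Every analytic self-map of the disk induces a bounded composition operator on `H²(β)`. -/
theorem exists_comp_operator {β : ℕ → {x : ℝ // 0 < x}} (hβ : EssentiallyDecreasing β)
    (hΔ : DeltaTwo β) {φ : 𝔻 → 𝔻} (hφ : IsHolo fun z => (φ z : ℂ)) :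
    ∃ S : WeightedHardy β →L[ℂ] WeightedHardy β,
      ∀ f, WeightedHardy.toFun β (S f) = WeightedHardy.toFun β f ∘ φ := by
  set Φ : ℂ → ℂ := extend fun z => (φ z : ℂ) with hΦ
  have hΦφ : ∀ z : 𝔻, Φ z = φ z := fun z => extend_coe _ z
  have hmaps : Set.MapsTo Φ (Metric.ball 0 1) (Metric.ball 0 1) := fun z hz => by
    have hz' : ‖z‖ < 1 := by simpa using hz
    simpa [hΦ, extend, hz'] using (φ (Complex.UnitDisc.mk z hz')).norm_lt_one
  have h0 : ‖Φ 0‖ < 1 := by simpa using hmaps (Metric.mem_ball_self one_pos)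
  have h0' := norm_nonneg (Φ 0)
  -- half of the constant of `le_one_sub_norm_of_mapsTo`, so that the image of the closed disk of
  -- radius `ρ` stays in an open disk
  set c : ℝ := (1 - ‖Φ 0‖) / 8 with hc
  have hc0 : 0 < c := by simp only [hc]; linarith
  have hc1 : c ≤ 1 := by simp only [hc]; linarith
  obtain ⟨B, hB, hbound⟩ := exists_weighted_bound hβ hΔ hc0 hc1
    (show 0 ≤ 2 / c by positivity)
  refine exists_operator (LinearMap.funLeft ℂ ℂ φ) hB fun f hf hfβ => ?_
  have hcomp : ∀ z ∈ Metric.ball (0 : ℂ) 1, extend (f ∘ φ) z = extend f (Φ z) := fun z hz => by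
    have hz' : ‖z‖ < 1 := by simpa using hz
    have h1 : Φ z = φ (Complex.UnitDisc.mk z hz') := by simp [hΦ, extend, hz']
    rw [h1, extend_coe]
    simp [extend, hz']
  have hfφ : IsHolo (f ∘ φ) := DifferentiableOn.congr (DifferentiableOn.comp hf hφ hmaps) hcomp
  refine ⟨hfφ, hbound f _ hf hfφ hfβ fun ρ hρ hρ1 => ?_⟩
  set R : ℝ := 1 - c * (1 - ρ) with hR
  have hR0 : 1 - c ≤ R := by nlinarith
  have hR1 : R < 1 := by nlinarith
  have hmapsR : Set.MapsTo Φ (Metric.closedBall 0 ρ) (Metric.ball 0 R) := fun z hz => by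
    have h1 := le_one_sub_norm_of_mapsTo hφ hmaps (Metric.closedBall_subset_ball hρ1 hz)
    rw [mem_closedBall_zero_iff] at hz
    rw [mem_ball_zero_iff]
    have h2 : (1 - ‖Φ 0‖) / 4 = 2 * c := by simp only [hc]; ring
    rw [h2] at h1
    nlinarith
  have hgap : c ≤ R - ‖Φ 0‖ := by
    have : 1 - ‖Φ 0‖ = 8 * c := by simp only [hc]; ring
    linarith
  have hmean := circleAverage_comp_le hf hφ hρ hρ1 (by linarith) hR1 hmapsR
  have hcongr : Real.circleAverage (fun z => ‖extend (LinearMap.funLeft ℂ ℂ φ f) z‖ ^ 2) 0 ρ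
      = Real.circleAverage (fun z => ‖extend f (Φ z)‖ ^ 2) 0 ρ :=
    Real.circleAverage_congr_sphere fun z hz => by
      have := hcomp z (sphere_abs_subset_ball hρ hρ1 hz)
      change ‖extend (f ∘ φ) z‖ ^ 2 = _
      simp only [this]
  rw [hcongr]
  refine hmean.trans (mul_le_mul_of_nonneg_right ?_
    (Real.circleAverage_nonneg_of_nonneg fun z _ => by positivity))
  exact div_le_div₀ (by norm_num) (by linarith) hc0 hgap

/-- `H²` embeds continuously into `H²(β)`, because `β` is bounded. -/
theorem exists_hardy_embedding {β : ℕ → {x : ℝ // 0 < x}} (hβ : EssentiallyDecreasing β) :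
    ∃ J : HardyTwo →L[ℂ] WeightedHardy β,
      ∀ f, WeightedHardy.toFun β (J f) = WeightedHardy.toFun _ f := by
  obtain ⟨C, hC, hβ⟩ := hβ
  have hβ0 := (β 0).2
  refine exists_operator LinearMap.id (B := C * β 0) (by positivity) fun f hf hf1 => ?_
  have hle : ∀ n, ‖coeff f n‖ ^ 2 * (β n : ℝ) ≤ C * β 0 * (‖coeff f n‖ ^ 2 * 1) := fun n => by
    have := mul_le_mul_of_nonneg_left (hβ 0 n (Nat.zero_le n)) (sq_nonneg ‖coeff f n‖)
    linarith
  have hs := Summable.of_nonneg_of_le (fun n => mul_nonneg (sq_nonneg _) (β n).2.le) hle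
    (hf1.mul_left _)
  refine ⟨hf, hs, ?_⟩
  rw [← tsum_mul_left]
  exact Summable.tsum_le_tsum hle hs (hf1.mul_left _)

/-! ### Reproducing kernels and completeness -/

/-- The doubling property makes `1 / β n` grow at most polynomially. -/
theorem summable_pow_div {β : ℕ → {x : ℝ // 0 < x}} {E : ℝ}
    (hE : HalfBound (fun n => (β n : ℝ)) E) {r : ℝ} (hr : 0 ≤ r) (hr1 : r < 1) :
    Summable fun n => r ^ n / (β n : ℝ) := by
  obtain ⟨p, hp⟩ := pow_unbounded_of_one_lt E (one_lt_two (α := ℝ))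
  have pos : ∀ n, 0 < (β n : ℝ) := fun n => (β n).2
  have hbound : ∀ n, 0 < n → 1 / (β n : ℝ) ≤ 1 / β 1 * (n : ℝ) ^ p := fun n => by
    induction n using Nat.strong_induction_on with
    | _ n ih =>
      intro hn
      rcases Nat.lt_or_ge n 2 with h | h
      · obtain rfl : n = 1 := by omega
        simp
      have h1 := ih (n / 2) (by omega) (by omega)
      have h2 : 1 / (β n : ℝ) ≤ E * (1 / β (n / 2)) := by
        rw [mul_one_div, div_le_div_iff₀ (pos _) (pos _), one_mul]
        exact hE n
      have h3 : ((n / 2 : ℕ) : ℝ) ^ p ≤ (n : ℝ) ^ p / 2 ^ p := by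
        rw [← div_pow]
        exact pow_le_pow_left₀ (by positivity) Nat.cast_div_le p
      have hm := pos (n / 2)
      have h1' := pos 1
      calc 1 / (β n : ℝ) ≤ E * (1 / β (n / 2)) := h2
        _ ≤ 2 ^ p * (1 / β 1 * ((n : ℝ) ^ p / 2 ^ p)) :=
            mul_le_mul hp.le (h1.trans (mul_le_mul_of_nonneg_left h3 (by positivity)))
              (by positivity) (by positivity)
        _ = 1 / β 1 * (n : ℝ) ^ p := by field_simp
  have hs := (summable_pow_mul_geometric_of_norm_lt_one (R := ℝ) p (r := r)
    (by rwa [Real.norm_of_nonneg hr])).mul_left (1 / (β 1 : ℝ))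
  rw [← summable_nat_add_iff 1] at hs ⊢
  refine Summable.of_nonneg_of_le (fun n => div_nonneg (pow_nonneg hr _) (pos _).le) (fun n => ?_) hs
  have := mul_le_mul_of_nonneg_right (hbound (n + 1) n.succ_pos) (pow_nonneg hr (n + 1))
  calc r ^ (n + 1) / (β (n + 1) : ℝ) = 1 / (β (n + 1) : ℝ) * r ^ (n + 1) := by ring
    _ ≤ _ := this
    _ = _ := by ring

/-- Every sequence `a` with `∑ |aₙ|² βₙ < ∞` is the coefficient sequence of an element of
`H²(β)`. -/
theorem exists_coeff_eq {β : ℕ → {x : ℝ // 0 < x}} {E : ℝ}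
    (hE : HalfBound (fun n => (β n : ℝ)) E) {a : ℕ → ℂ}
    (ha : Summable fun n => ‖a n‖ ^ 2 * (β n : ℝ)) :
    ∃ f : WeightedHardy β, ∀ n, coeff (WeightedHardy.toFun β f) n = a n := by
  obtain ⟨f, hf, hfa⟩ := exists_isHolo_coeff_eq (a := a) fun r hr hr1 => by
    -- `|a| r ^ n ≤ |a|² β + r ^ (2 n) / β`
    have h1 := ha.add (summable_pow_div hE (r := r ^ 2) (by positivity) (by nlinarith))
    refine Summable.of_nonneg_of_le (fun n => by positivity) (fun n => ?_) h1
    have hβ := (β n).2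
    have h2 : ((r ^ 2) ^ n / (β n : ℝ)) = (r ^ n / (β n : ℝ)) ^ 2 * β n := by
      field_simp
      ring
    have h3 : ‖a n‖ * r ^ n = ‖a n‖ * (r ^ n / (β n : ℝ)) * β n := by field_simp
    rw [h2, h3]
    nlinarith [mul_nonneg (sq_nonneg (‖a n‖ - r ^ n / (β n : ℝ))) hβ.le,
      mul_nonneg (mul_nonneg (norm_nonneg (a n)) (by positivity : 0 ≤ r ^ n / (β n : ℝ))) hβ.le]
  exact ⟨⟨f, hf, by simpa only [hfa] using ha⟩, hfa⟩

theorem toFun_injective (β : ℕ → {x : ℝ // 0 < x}) :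
    Function.Injective (WeightedHardy.toFun β) := Subtype.val_injective

theorem completeSpace_weightedHardy {β : ℕ → {x : ℝ // 0 < x}} {E : ℝ}
    (hE : HalfBound (fun n => (β n : ℝ)) E) : CompleteSpace (WeightedHardy β) := by
  have hsq : ∀ (z : ℂ) (n : ℕ), ‖z * (Real.sqrt (β n) : ℂ)‖ ^ 2 = ‖z‖ ^ 2 * (β n : ℝ) :=
    fun z n => by
      rw [norm_mul, mul_pow, Complex.norm_real, Real.norm_of_nonneg (Real.sqrt_nonneg _),
        Real.sq_sqrt (β n).2.le]
  have hmem : ∀ f : WeightedHardy β,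
      Memℓp (fun n => coeff (WeightedHardy.toFun β f) n * (Real.sqrt (β n) : ℂ)) 2 := fun f => by
    rw [memℓp_gen_iff (by norm_num)]
    simpa only [ENNReal.toReal_ofNat, Real.rpow_two, hsq] using WeightedHardy.summable β f
  -- `f ↦ (aₙ √βₙ)` is an isometry onto `ℓ²`
  let L : WeightedHardy β →ₗ[ℂ] lp (fun _ : ℕ => ℂ) 2 :=
    { toFun := fun f => ⟨_, hmem f⟩
      map_add' := fun f g => Subtype.ext (funext fun n => by
        change coeff (WeightedHardy.toFun β (f + g)) n * _ = _ * _ + _ * _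
        rw [map_add, coeff_add (WeightedHardy.isHolo β f) (WeightedHardy.isHolo β g), add_mul])
      map_smul' := fun c f => Subtype.ext (funext fun n => by
        change coeff (WeightedHardy.toFun β (c • f)) n * _ = c * (_ * _)
        rw [map_smul, coeff_smul c (WeightedHardy.isHolo β f), mul_assoc]) }
  have hL : ∀ f n, L f n = coeff (WeightedHardy.toFun β f) n * (Real.sqrt (β n) : ℂ) :=
    fun _ _ => rfl
  have hnorm : ∀ f, ‖L f‖ = ‖f‖ := fun f => by
    have h1 := lp.norm_rpow_eq_tsum (p := 2) (by norm_num) (L f)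
    have h2 : ‖L f‖ ^ 2 = ‖f‖ ^ 2 := by
      rw [WeightedHardy.norm_sq_eq]
      simpa only [ENNReal.toReal_ofNat, Real.rpow_two, hL, hsq] using h1
    exact (pow_left_inj₀ (norm_nonneg _) (norm_nonneg _) two_ne_zero).1 h2
  have hsurj : Function.Surjective L := fun u => by
    have hu := (memℓp_gen_iff (by norm_num : 0 < (2 : ENNReal).toReal)).1 (lp.memℓp u)
    have hne : ∀ n, (Real.sqrt (β n) : ℂ) ≠ 0 := fun n => by
      exact_mod_cast (Real.sqrt_pos.2 (β n).2).ne'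
    obtain ⟨f, hf⟩ := exists_coeff_eq hE (a := fun n => u n / (Real.sqrt (β n) : ℂ)) (by
      simp_rw [← hsq, div_mul_cancel₀ _ (hne _)]
      simpa using hu)
    refine ⟨f, Subtype.ext (funext fun n => ?_)⟩
    change coeff (WeightedHardy.toFun β f) n * (Real.sqrt (β n) : ℂ) = u n
    rw [hf, div_mul_cancel₀ _ (hne n)]
  have hiso : Isometry L := AddMonoidHomClass.isometry_of_norm L hnorm
  exact (hiso.isUniformInducing.completeSpace_congr hsurj).2 inferInstance

/-- The reproducing kernel at `a` is `∑ conj a ^ n z ^ n / βₙ`. -/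
theorem exists_kernel {β : ℕ → {x : ℝ // 0 < x}} {E : ℝ}
    (hE : HalfBound (fun n => (β n : ℝ)) E) (a : 𝔻) :
    ∃ K : WeightedHardy β, (∀ f, inner ℂ K f = WeightedHardy.toFun β f a) ∧
      ‖K‖ ^ 2 = ∑' n, (‖(a : ℂ)‖ ^ 2) ^ n / (β n : ℝ) := by
  have hterm : ∀ n, ‖conj (a : ℂ) ^ n / ((β n : ℝ) : ℂ)‖ ^ 2 * (β n : ℝ)
      = (‖(a : ℂ)‖ ^ 2) ^ n / (β n : ℝ) := fun n => by
    have hβ := (β n).2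
    rw [norm_div, norm_pow, RCLike.norm_conj, Complex.norm_real, Real.norm_of_nonneg hβ.le]
    field_simp
    ring
  obtain ⟨K, hK⟩ := exists_coeff_eq hE (a := fun n => conj (a : ℂ) ^ n / ((β n : ℝ) : ℂ)) (by
    simp_rw [hterm]
    exact summable_pow_div hE (by positivity) a.sq_norm_lt_one)
  refine ⟨K, fun f => ?_, ?_⟩
  · have h1 := (hasSum_coeff (WeightedHardy.isHolo β f) a).tsum_eq
    rw [← h1]
    change ∑' n, conj (coeff (WeightedHardy.toFun β K) n) * coeff (WeightedHardy.toFun β f) n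
      * ((β n : ℝ) : ℂ) = _
    refine tsum_congr fun n => ?_
    have hβ : ((β n : ℝ) : ℂ) ≠ 0 := by exact_mod_cast (β n).2.ne'
    rw [hK, map_div₀, map_pow, Complex.conj_conj, Complex.conj_ofReal]
    field_simp
  · rw [WeightedHardy.norm_sq_eq]
    simp_rw [hK, hterm]

/-- The kernel functions `κ(r) = ∑ rⁿ / βₙ` inherit a doubling property from `β`. -/
theorem tsum_pow_div_le {β : ℕ → {x : ℝ // 0 < x}} {E : ℝ} (hE1 : 1 ≤ E)
    (hE : HalfBound (fun n => (β n : ℝ)) E) {r : ℝ} (hr : 0 ≤ r) (hr1 : r < 1) :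
    ∑' n, r ^ n / (β n : ℝ) ≤ 2 * E * ∑' n, (r ^ 2) ^ n / (β n : ℝ) := by
  have pos : ∀ n, 0 < (β n : ℝ) := fun n => (β n).2
  have hs := summable_pow_div hE hr hr1
  have hs2 := summable_pow_div hE (r := r ^ 2) (by positivity) (by nlinarith)
  have hinv : ∀ n, 1 / (β n : ℝ) ≤ E * (1 / β (n / 2)) := fun n => by
    rw [mul_one_div, div_le_div_iff₀ (pos _) (pos _), one_mul]
    exact hE n
  have heven : ∀ m, r ^ (2 * m) / (β (2 * m) : ℝ) ≤ E * ((r ^ 2) ^ m / (β m : ℝ)) := fun m => by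
    have h1 := mul_le_mul_of_nonneg_left (hinv (2 * m)) (pow_nonneg hr (2 * m))
    rw [show 2 * m / 2 = m by omega] at h1
    calc _ = r ^ (2 * m) * (1 / (β (2 * m) : ℝ)) := by ring
      _ ≤ _ := h1
      _ = _ := by rw [pow_mul]; ring
  have hodd : ∀ m, r ^ (2 * m + 1) / (β (2 * m + 1) : ℝ) ≤ E * ((r ^ 2) ^ m / (β m : ℝ)) :=
    fun m => by
      have h1 := mul_le_mul_of_nonneg_left (hinv (2 * m + 1)) (pow_nonneg hr (2 * m + 1))
      rw [show (2 * m + 1) / 2 = m by omega] at h1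
      have h2 : r ^ (2 * m + 1) ≤ (r ^ 2) ^ m := by
        rw [← pow_mul]
        exact pow_le_pow_of_le_one hr hr1.le (Nat.le_succ _)
      have hm := pos m
      calc _ = r ^ (2 * m + 1) * (1 / (β (2 * m + 1) : ℝ)) := by ring
        _ ≤ r ^ (2 * m + 1) * (E * (1 / β m)) := h1
        _ ≤ (r ^ 2) ^ m * (E * (1 / β m)) := mul_le_mul_of_nonneg_right h2 (by positivity)
        _ = _ := by ring
  have he : Summable fun m => r ^ (2 * m) / (β (2 * m) : ℝ) :=
    hs.comp_injective (i := fun m : ℕ => 2 * m) fun a b h => by dsimp only at h; omega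
  have ho : Summable fun m => r ^ (2 * m + 1) / (β (2 * m + 1) : ℝ) :=
    hs.comp_injective (i := fun m : ℕ => 2 * m + 1) fun a b h => by dsimp only at h; omega
  rw [← tsum_even_add_odd (f := fun n => r ^ n / (β n : ℝ)) he ho]
  have h1 := Summable.tsum_le_tsum heven he (hs2.mul_left E)
  have h2 := Summable.tsum_le_tsum hodd ho (hs2.mul_left E)
  rw [tsum_mul_left] at h1 h2
  linarith

theorem tsum_pow_div_mono {β : ℕ → {x : ℝ // 0 < x}} {E : ℝ}
    (hE : HalfBound (fun n => (β n : ℝ)) E) {r s : ℝ} (hr : 0 ≤ r) (hrs : r ≤ s) (hs1 : s < 1) :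
    ∑' n, r ^ n / (β n : ℝ) ≤ ∑' n, s ^ n / (β n : ℝ) :=
  Summable.tsum_le_tsum (fun n => div_le_div_of_nonneg_right (pow_le_pow_left₀ hr hrs n) (β n).2.le)
    (summable_pow_div hE hr (hrs.trans_lt hs1)) (summable_pow_div hE (hr.trans hrs) hs1)

theorem tsum_pow_div_iterate_le {β : ℕ → {x : ℝ // 0 < x}} {E : ℝ} (hE1 : 1 ≤ E)
    (hE : HalfBound (fun n => (β n : ℝ)) E) {r : ℝ} (hr : 0 ≤ r) (hr1 : r < 1) (j : ℕ) :
    ∑' n, r ^ n / (β n : ℝ) ≤ (2 * E) ^ j * ∑' n, (r ^ 2 ^ j) ^ n / (β n : ℝ) := by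
  induction j with
  | zero => simp
  | succ j ih =>
    have h1 := tsum_pow_div_le hE1 hE (pow_nonneg hr (2 ^ j))
      (pow_lt_one₀ hr hr1 (by positivity))
    refine ih.trans ?_
    calc _ ≤ (2 * E) ^ j * (2 * E * ∑' n, ((r ^ 2 ^ j) ^ 2) ^ n / (β n : ℝ)) :=
          mul_le_mul_of_nonneg_left h1 (by positivity)
      _ = _ := by rw [← pow_mul, ← pow_succ]; ring

/-- If `m` is large compared with `(1 - s) / (1 - r)`, the power `r ^ m` is below `s`. -/
theorem pow_le_max_half {r s : ℝ} (hr : 0 ≤ r) (hr1 : r < 1) {m : ℕ}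
    (hm : 2 * ((1 - s) / (1 - r)) ≤ m) : r ^ m ≤ max s (1 / 2) := by
  have h1r : 0 < 1 - r := by linarith
  have hm' : 2 * (1 - s) ≤ m * (1 - r) := by
    rw [← mul_div_assoc, div_le_iff₀ h1r] at hm
    exact hm
  -- Bernoulli's inequality for `2 - r ≤ 1 / r`
  have h1 := one_add_mul_le_pow (a := 1 - r) (by linarith) m
  have h2 : r ^ m * (1 + (1 - r)) ^ m ≤ 1 := by
    rw [← mul_pow]
    exact pow_le_one₀ (by nlinarith) (by nlinarith)
  have h3 : r ^ m * (1 + m * (1 - r)) ≤ 1 :=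
    (mul_le_mul_of_nonneg_left h1 (pow_nonneg hr m)).trans h2
  have h4 : r ^ m * (1 + 2 * (1 - max s (1 / 2))) ≤ 1 := by
    refine (mul_le_mul_of_nonneg_left ?_ (pow_nonneg hr m)).trans h3
    linarith [le_max_left s (1 / 2)]
  rcases le_or_gt 1 (max s (1 / 2)) with h | h
  · exact (pow_le_one₀ hr hr1.le).trans h
  · have h5 := le_max_right s (1 / 2)
    set t := max s (1 / 2)
    -- `1 ≤ t (1 + 2 (1 - t))` for `1 / 2 ≤ t ≤ 1`
    have h6 : 1 ≤ t * (1 + 2 * (1 - t)) := by nlinarith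
    exact le_of_mul_le_mul_right (h4.trans h6) (by linarith)

/-- The control of the kernel functions that is behind the estimate for `‖K_a‖ / ‖K_b‖`. -/
theorem exists_tsum_pow_div_le {β : ℕ → {x : ℝ // 0 < x}} {E : ℝ} (hE1 : 1 ≤ E)
    (hE : HalfBound (fun n => (β n : ℝ)) E) :
    ∃ D : ℝ, 0 ≤ D ∧ ∀ r s : ℝ, 0 ≤ r → r < 1 → 0 ≤ s → s < 1 →
      ∑' n, r ^ n / (β n : ℝ) ≤ D * (2 * E) ^ ⌈2 * ((1 - s) / (1 - r))⌉₊
        * ∑' n, s ^ n / (β n : ℝ) := by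
  have hβ0 := (β 0).2
  have hnn : ∀ r : ℝ, 0 ≤ r → ∀ n, 0 ≤ r ^ n / (β n : ℝ) := fun r hr n =>
    div_nonneg (pow_nonneg hr n) (β n).2.le
  have hκ0 : ∀ s : ℝ, 0 ≤ s → s < 1 → 1 ≤ (β 0 : ℝ) * ∑' n, s ^ n / (β n : ℝ) := fun s hs hs1 => by
    have h1 := (summable_pow_div hE hs hs1).le_tsum 0 fun n _ => hnn s hs n
    have h2 := mul_le_mul_of_nonneg_left h1 hβ0.le
    rwa [pow_zero, mul_one_div, div_self hβ0.ne'] at h2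
  set κ2 := ∑' n, (1 / 2 : ℝ) ^ n / (β n : ℝ) with hκ2
  have hκ2' : 0 ≤ κ2 := tsum_nonneg fun n => hnn _ (by norm_num) n
  refine ⟨1 + κ2 * β 0, by positivity, fun r s hr hr1 hs hs1 => ?_⟩
  set j := ⌈2 * ((1 - s) / (1 - r))⌉₊ with hj
  have hm : 2 * ((1 - s) / (1 - r)) ≤ ((2 ^ j : ℕ) : ℝ) :=
    (Nat.le_ceil _).trans (by exact_mod_cast Nat.lt_two_pow_self.le)
  have h1 := tsum_pow_div_iterate_le hE1 hE hr hr1 j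
  have h2 := tsum_pow_div_mono hE (pow_nonneg hr (2 ^ j)) (pow_le_max_half hr hr1 hm)
    (max_lt hs1 (by norm_num))
  have hκs : 0 ≤ ∑' n, s ^ n / (β n : ℝ) := tsum_nonneg fun n => hnn s hs n
  have h3 : ∑' n, (max s (1 / 2)) ^ n / (β n : ℝ)
      ≤ (1 + κ2 * β 0) * ∑' n, s ^ n / (β n : ℝ) := by
    have h4 := mul_le_mul_of_nonneg_left (hκ0 s hs hs1) hκ2'
    rcases max_cases s (1 / 2) with ⟨h, _⟩ | ⟨h, _⟩ <;> rw [h]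
    · have : 0 ≤ κ2 * β 0 * ∑' n, s ^ n / (β n : ℝ) := by positivity
      linarith
    · linarith
  calc _ ≤ (2 * E) ^ j * ((1 + κ2 * β 0) * ∑' n, s ^ n / (β n : ℝ)) :=
        h1.trans (mul_le_mul_of_nonneg_left (h2.trans h3) (by positivity))
    _ = _ := by ring

/-! ### Multipliers -/

/-- A multiplier `w` of `H²(β)` is bounded: multiplication by `w` is a bounded operator `T` by the
closed graph theorem, and `w a ‖K_a‖² = ⟪K_a, T K_a⟫`. -/
theorem multipliers_subset {β : ℕ → {x : ℝ // 0 < x}} {E : ℝ}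
    (hE : HalfBound (fun n => (β n : ℝ)) E) :
    multipliers (WeightedHardy.toFun β) ⊆ HInfty := by
  rintro w ⟨hw, hmul⟩
  have := completeSpace_weightedHardy hE
  choose g hg using hmul
  let T : WeightedHardy β →ₗ[ℂ] WeightedHardy β :=
    { toFun := g
      map_add' := fun f₁ f₂ => toFun_injective β (by rw [map_add, hg, hg, hg, map_add, mul_add])
      map_smul' := fun c f => toFun_injective β (by
        rw [RingHom.id_apply, map_smul, hg, hg, map_smul, mul_smul_comm]) }
  have hT : ∀ f, WeightedHardy.toFun β (T f) = w * WeightedHardy.toFun β f := hg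
  have hev : ∀ a : 𝔻, Continuous fun f : WeightedHardy β => WeightedHardy.toFun β f a := fun a => by
    obtain ⟨K, hK, -⟩ := exists_kernel hE a
    simp_rw [← hK]
    exact continuous_const.inner continuous_id
  let S : WeightedHardy β →L[ℂ] WeightedHardy β := .ofSeqClosedGraph (g := T) fun u x y hu hTu =>
    toFun_injective β (funext fun a => by
      refine tendsto_nhds_unique (((hev a).tendsto y).comp hTu) ?_
      simp only [Function.comp_def, hT, Pi.mul_apply]
      exact (((hev a).tendsto x).comp hu).const_mul (w a))
  refine ⟨hw, ‖S‖, fun a => ?_⟩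
  obtain ⟨K, hK, hKn⟩ := exists_kernel hE a
  have hβ0 := (β 0).2
  have hpos : 0 < ‖K‖ ^ 2 := by
    rw [hKn]
    exact (summable_pow_div hE (by positivity) a.sq_norm_lt_one).tsum_pos
      (fun n => div_nonneg (by positivity) (β n).2.le) 0 (by simpa using hβ0)
  have h1 : inner ℂ K (S K) = w a * inner ℂ K K := by
    rw [hK, hK]
    exact congrFun (hT K) a
  have h2 : ‖w a‖ * ‖K‖ ^ 2 ≤ ‖S‖ * ‖K‖ ^ 2 := by
    have h3 := norm_inner_le_norm (𝕜 := ℂ) K (S K)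
    rw [h1, norm_mul, inner_self_eq_norm_sq_to_K, norm_pow] at h3
    simp only [Complex.coe_algebraMap, Complex.norm_real, norm_norm] at h3
    nlinarith [mul_le_mul_of_nonneg_left (S.le_opNorm K) (norm_nonneg K)]
  exact le_of_mul_le_mul_right h2 hpos

end HardyWeighted

/-! ### Admissibility -/

open HardyWeighted in
theorem proposition5p2 (β : ℕ → {x : ℝ // 0 < x})
    (hβ : HardyWeighted.EssentiallyDecreasing β) (hΔ : HardyWeighted.DeltaTwo β) :
    HardyWeighted.IsAdmissible (HardyWeighted.WeightedHardy.toFun β) := by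
  obtain ⟨E, hE1, hE⟩ := exists_halfBound hβ hΔ
  refine ⟨completeSpace_weightedHardy hE, toFun_injective β, WeightedHardy.isHolo β, fun c => ?_,
    exists_hardy_embedding hβ, (multipliers_subset hE).antisymm fun w hw => ⟨hw.1, fun f => ?_⟩,
    fun φ hφ => exists_comp_operator hβ hΔ hφ.1, ?_⟩
  · obtain ⟨f, hf⟩ := exists_coeff_eq hE (a := fun n => if n = 0 then c else 0)
      (summable_of_ne_finset_zero (s := {0}) fun n hn => by simp_all)
    refine ⟨f, funext fun z => ?_⟩
    have h1 := hasSum_coeff (WeightedHardy.isHolo β f) z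
    simp only [hf, ite_mul, zero_mul] at h1
    refine h1.unique ?_
    have h2 := hasSum_ite_eq (α := ℂ) 0 c
    convert h2 using 2 with n
    split_ifs with h <;> simp [h]
  · obtain ⟨S, hS⟩ := exists_mul_operator hβ hΔ hw
    exact ⟨S f, hS f⟩
  · choose K hK hKn using fun a => exists_kernel hE a
    refine ⟨K, hK, ?_⟩
    obtain ⟨D, hD, hbound⟩ := exists_tsum_pow_div_le hE1 hE
    refine ⟨fun x => Real.sqrt (D * (2 * E) ^ ⌈2 * (2 * x)⌉₊), fun x _ => Real.sqrt_nonneg _,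
      fun x _ y _ hxy => Real.sqrt_le_sqrt ?_, fun a b => ?_⟩
    · refine mul_le_mul_of_nonneg_left (pow_le_pow_right₀ (by linarith) (Nat.ceil_mono ?_)) hD
      linarith
    · have ha := a.norm_lt_one
      have hb := b.norm_lt_one
      have ha0 := norm_nonneg (a : ℂ)
      have hb0 := norm_nonneg (b : ℂ)
      have h1 := hbound (‖(a : ℂ)‖ ^ 2) (‖(b : ℂ)‖ ^ 2) (by positivity) a.sq_norm_lt_one
        (by positivity) b.sq_norm_lt_one
      rw [← hKn, ← hKn] at h1
      -- `1 - |b|² ≤ 2 (1 - |b|)` and `1 - |a| ≤ 1 - |a|²`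
      have hratio : (1 - ‖(b : ℂ)‖ ^ 2) / (1 - ‖(a : ℂ)‖ ^ 2)
          ≤ 2 * ((1 - ‖(b : ℂ)‖) / (1 - ‖(a : ℂ)‖)) := by
        rw [← mul_div_assoc]
        exact div_le_div₀ (by linarith) (by nlinarith) (by linarith) (by nlinarith)
      have h2 : ‖K a‖ ^ 2 ≤ D * (2 * E) ^ ⌈2 * (2 * ((1 - ‖(b : ℂ)‖) / (1 - ‖(a : ℂ)‖)))⌉₊
          * ‖K b‖ ^ 2 := by
        refine h1.trans (mul_le_mul_of_nonneg_right (mul_le_mul_of_nonneg_left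
          (pow_le_pow_right₀ (by linarith) (Nat.ceil_mono ?_)) hD) (sq_nonneg _))
        linarith
      refine Real.le_sqrt_of_sq_le ?_
      rw [div_pow]
      exact div_le_of_le_mul₀ (sq_nonneg _) (by positivity) h2
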